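/- **Setting.** Digraphs may have self-loops. A *tournament* is a set of looped nodes, any two distinct ones joined by exactly one edge, with no cycles other than the loops. Two nodes are *connected* if at least one of the two edges between them is present, and joined by a *double edge* if both are. For $p\in\mathbb N$ put $k=\lceil\log_{1.5}4p^2\rceil$ and $n=\lfloor 2^{k-c}\rfloor$ with $c=10+\frac16$. For a node set $S$, let $U_S$ (resp. $L_S$) be the set of un-looped nodes (resp. looped nodes outside $S$) connected to every node of $S$, and $U_0(S)$ the set of un-looped nodes $u$ with no single edge into $S$ (no $s\in S$ with $(u,s)$ present and $(s,u)$ absent). Let $\mathcal N_p$ be the set of digraphs on $\{1,\dots,2n+k-1\}$ that have exactly one $k$-node tournament $T$ and satisfy $|U|=n$ for the set $U$ of un-looped nodes, $|L|=n-1$ for the set $L$ of looped nodes outside $T$, and $|U_0(T)|=|U_T|=|L_T|+1=2p^2$. "Almost every $G\in\mathcal N$" means: with probability $1-o(1)$ as $p\to\infty$ under the uniform distribution on $\mathcal N_p$. **Colorings.** Every edge (loops included) is colored blank, grey, green or red; non-edges are "absent". Let $\widetilde T$ be the set of nodes with a blank loop (the *blank nodes*). A coloring comes with a classification of its links (node pairs)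 that have a blank non-loop edge. At most one of the following directed types, in one direction, is given to a pair; in each of them the forward edge $(x,y)$ is blank, and: * $h$: exactly one of $x,y$ is looped, and $(y,x)$ is grey; * $v$: exactly one of $x,y$ is looped, and $(y,x)$ is blank or, if $x$ is looped, blank or green; * $d_1$, $d_2$: both nodes are un-looped, and $(y,x)$ is red, respectively absent; * $I$: exactly one of $x,y$ is looped, $y\notin\widetilde T$, and $(y,x)$ is green, red or absent; * $K$: $x$ is un-looped, $y\in\widetilde T$, and $(y,x)$ is blank or absent; * $M$: both nodes are looped, not both are in $\widetilde T$, and $(y,x)$ is not blank. A *$C$-link* is a double edge between an un-looped node and a node of $\widetilde T$ with exactly one blank edge; it may coincide with a link of another type. Every blank non-loop edge lies in a link of one of these eight types. The constraints are: * **A.** $\widetilde T$ forms a tournament (its size is not prescribed) whose non-loop edges are green; if $\widetilde T$ is non-empty, $\widetilde t_1$ denotes its sink. * **B.** Each non-blank node has at most one $K$-link, at most one $M$-link, and at most one incoming and at most one outgoing link of each of the types $h,v,d_1,d_2,I$. $I$-links run within $U_{\widetilde T}\cup L_{\widetilde T}\cup\widetilde T$; $h,v,d_1,d_2$-links run within $U_0(\widetilde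 T)\cup L_{\widetilde T}\cup\{\widetilde t_1\}$. * **C.** Every $K$-link is between $U_{\widetilde T}$ and $\widetilde T$. * **D.** $M$-links run between nodes of $L_{\widetilde T}\cup\widetilde T$. **Counts.** Let $\widetilde b_0$ be the number of blank edges within $\widetilde T$; let $\widetilde b_1,\widetilde b_2,\widetilde b_3,\widetilde b_4,\widetilde b_6,\widetilde b_7$ be the numbers of blank edges in links of type $h,v,d_1,d_2,I,M$ respectively; let $\widetilde b_5$ be the number of $K$-links, and $\widetilde b_8$ the number of double edges between $U$ and $\widetilde T$ at least one of whose two edges is blank (so a double blank $K$-link contributes one blank to $K$ and one to $C$). Let $\widetilde b=\sum_i\widetilde b_i$. Let $b_0=k$, $b_1=4p^2$, $b_2=8p^2$, $b_3=b_4=b_5=2p^2$, $b_6=4p^2-1$, $b_7=2p^2-1$, let $b_8$ be the number of double edges between $U$ and $T$, and $b=\sum_i b_i$. **Proposition 4.** For almost every $G\in\mathcal N$, every coloring of $G$ (with a classification as above) that observes A–D and has $\widetilde b\ge b$ satisfies $\widetilde T=T$ and $\widetilde b_i\le b_i$ for all $i$; hence $\widetilde b_i=b_i$ for all $i=0,\dots,8$.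 -/

import Mathlib

open Filter Topology

namespace GraphColoration

/-! ### Digraphs, tournaments, and the node classes attached to a node set -/

section Graph

variable {V : Type*} (G : Digraph V)

/-- A node with a self-loop. -/
def Looped (x : V) : Prop := G.Adj x x

/-- Two nodes joined by a single or a double edge. -/
def Connected (x y : V) : Prop := G.Adj x y ∨ G.Adj y x

/-- Two nodes joined by both edges. -/
def Double (x y : V) : Prop := G.Adj x y ∧ G.Adj y x

/-- The nodes of `S` form a transitive tournament: every node of `S` has a self-loop, two distinct
nodes are joined by exactly one edge, and there are no cycles besides the self-loops. -/
def IsTournament (S : Set V) : Prop :=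
  (∀ x ∈ S, G.Adj x x) ∧
  (∀ x ∈ S, ∀ y ∈ S, x ≠ y → (G.Adj x y ↔ ¬ G.Adj y x)) ∧
  (∀ x ∈ S, ∀ y ∈ S, ∀ z ∈ S, G.Adj x y → G.Adj y z → G.Adj x z)

/-- The sink of `S`. -/
def IsSink (S : Set V) (t : V) : Prop :=
  t ∈ S ∧ ∀ s ∈ S, s ≠ t → ¬ G.Adj t s

/-- The set `U` of un-looped nodes. -/
def unlooped : Set V := {x | ¬ Looped G x}

/-- The looped nodes outside `S`; this is `L` when `S = T`. -/
def loopedOff (S : Set V) : Set V := {x | Looped G x ∧ x ∉ S}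

/-- `U_S`: the un-looped nodes connected to every node of `S`. -/
def unloopedConn (S : Set V) : Set V := {x | ¬ Looped G x ∧ ∀ s ∈ S, Connected G x s}

/-- `L_S`: the looped nodes outside `S` connected to every node of `S`. -/
def loopedConn (S : Set V) : Set V := {x | Looped G x ∧ x ∉ S ∧ ∀ s ∈ S, Connected G x s}

/-- `U_0` with respect to `S`: the un-looped nodes with no single edge into `S`. -/
def unloopedZero (S : Set V) : Set V :=
  {x | ¬ Looped G x ∧ ∀ s ∈ S, ¬ (G.Adj x s ∧ ¬ G.Adj s x)}

end Graph

/-! ### The parameters and the class `𝒩` -/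

/-- `k = ⌈log_{1.5} 4p²⌉`. -/
noncomputable def kOf (p : ℕ) : ℕ := ⌈Real.logb (3 / 2) (4 * (p : ℝ) ^ 2)⌉₊

/-- `n = ⌊2^{k-c}⌋` with `c = 10 + 1/6`. -/
noncomputable def nOf (p : ℕ) : ℕ := ⌊(2 : ℝ) ^ ((kOf p : ℝ) - (10 + 1 / 6))⌋₊

/-- The number `2n + k - 1` of nodes. -/
noncomputable def numNodes (p : ℕ) : ℕ := 2 * nOf p + kOf p - 1

/-- `𝒩_p`: the labelled digraphs on `2n + k - 1` nodes that have exactly one `k`-node tournament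
`T`, and whose sets `U, L, U_T, L_T, U_0` have the prescribed sizes. -/
def classN (p : ℕ) : Set (Digraph (Fin (numNodes p))) :=
  {G | ∃ T : Set (Fin (numNodes p)),
    {S | IsTournament G S ∧ S.ncard = kOf p} = {T} ∧
    (unlooped G).ncard = nOf p ∧
    (loopedOff G T).ncard + 1 = nOf p ∧
    (unloopedZero G T).ncard = 2 * p ^ 2 ∧
    (unloopedConn G T).ncard = 2 * p ^ 2 ∧
    (loopedConn G T).ncard + 1 = 2 * p ^ 2}

/-! ### Colorings and links -/

/-- The four colors of edges, and `absent` for the non-edges. -/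
inductive Color
  | absent
  | blank
  | grey
  | green
  | red

/-- The directed types of links with a blank non-loop edge, other than `C`. -/
inductive LinkType
  | h
  | v
  | d₁
  | d₂
  | K
  | I
  | M

/-- An edge coloring of `G` (self-loops included). -/
structure EdgeColoring {V : Type*} (G : Digraph V) where
  color : V → V → Color
  absent_iff : ∀ x y, color x y = Color.absent ↔ ¬ G.Adj x y

namespace EdgeColoring

variable {V : Type*} {G : Digraph V} (χ : EdgeColoring G)

/-- The edge from `x` to `y` is present and blank. -/
def Blank (x y : V) : Prop := χ.color x y = Color.blank

/-- `T̃`: the set of nodes whose self-loop is blank. -/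
def blankNodes : Set V := {x | χ.Blank x x}

/-- Exactly one of the two nodes has a self-loop. -/
def Alternating (_ : EdgeColoring G) (x y : V) : Prop := Looped G x ↔ ¬ Looped G y

/-- How a link of a given type from `x` to `y` looks. -/
def Pattern : LinkType → V → V → Prop
  | .h, x, y => χ.Alternating x y ∧ χ.Blank x y ∧ χ.color y x = Color.grey
  | .v, x, y => χ.Alternating x y ∧ χ.Blank x y ∧
      (χ.Blank y x ∨ (Looped G x ∧ χ.color y x = Color.green))
  | .d₁, x, y => ¬ Looped G x ∧ ¬ Looped G y ∧ χ.Blank x y ∧ χ.color y x = Color.red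
  | .d₂, x, y => ¬ Looped G x ∧ ¬ Looped G y ∧ χ.Blank x y ∧ χ.color y x = Color.absent
  | .K, x, y => ¬ Looped G x ∧ y ∈ χ.blankNodes ∧ χ.Blank x y ∧
      (χ.Blank y x ∨ χ.color y x = Color.absent)
  | .I, x, y => χ.Alternating x y ∧ y ∉ χ.blankNodes ∧ χ.Blank x y ∧
      (χ.color y x = Color.green ∨ χ.color y x = Color.red ∨ χ.color y x = Color.absent)
  | .M, x, y => Looped G x ∧ Looped G y ∧ ¬ (x ∈ χ.blankNodes ∧ y ∈ χ.blankNodes) ∧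
      χ.Blank x y ∧ ¬ χ.Blank y x

/-- A `C`-link: `u` is un-looped, `t ∈ T̃`, both edges are present, exactly one is blank. -/
def IsCLink (u t : V) : Prop :=
  ¬ Looped G u ∧ t ∈ χ.blankNodes ∧ Double G u t ∧ Xor (χ.Blank u t) (χ.Blank t u)

end EdgeColoring

/-- A coloring of `G` in which every link with a blank non-loop edge is assigned a directed type.
The types `h, v, d₁, d₂, K, I, M` exclude each other; a `C`-link, and the `C`-part of a double
blank link, lies between an un-looped node and `T̃` and is read off the colors. -/
structure TypedColoring {V : Type*} (G : Digraph V) extends EdgeColoring G where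
  /-- `link τ x y`: there is a link of type `τ` from `x` to `y`. -/
  link : LinkType → V → V → Prop
  pattern : ∀ τ x y, link τ x y → toEdgeColoring.Pattern τ x y
  type_unique : ∀ σ τ x y, link σ x y → link τ x y → σ = τ
  directed : ∀ σ τ x y, link σ x y → ¬ link τ y x
  typed : ∀ x y, x ≠ y → toEdgeColoring.Blank x y →
    (∃ τ, link τ x y ∨ link τ y x) ∨ toEdgeColoring.IsCLink x y ∨ toEdgeColoring.IsCLink y x

namespace TypedColoring

variable {V : Type*} {G : Digraph V} (χ : TypedColoring G)

/-- `T̃`, the set of nodes with a blank self-loop. -/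
abbrev blankNodes : Set V := χ.toEdgeColoring.blankNodes

/-- Constraint A: `T̃` forms a tournament whose non-loop edges are green (the loops are blank by
definition of `T̃`). The number of nodes of `T̃` is not prescribed. -/
def ConstraintA : Prop :=
  IsTournament G χ.blankNodes ∧
  ∀ x ∈ χ.blankNodes, ∀ y ∈ χ.blankNodes, x ≠ y → G.Adj x y → χ.color x y = Color.green

/-- `U_T̃ ∪ L_T̃ ∪ T̃`. -/
def inputRegion : Set V :=
  unloopedConn G χ.blankNodes ∪ loopedConn G χ.blankNodes ∪ χ.blankNodes

/-- `U_0̃ ∪ L_T̃ ∪ {t̃₁}`, where `t̃₁` is the sink of `T̃`. -/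
def gridRegion : Set V :=
  unloopedZero G χ.blankNodes ∪ loopedConn G χ.blankNodes ∪ {t | IsSink G χ.blankNodes t}

/-- Constraint B. -/
def ConstraintB : Prop :=
  -- at most one link of type `K` or `M`, in whatever direction, at a non-blank node
  (∀ τ, τ = LinkType.K ∨ τ = LinkType.M → ∀ x, x ∉ χ.blankNodes → ∀ y z,
    χ.link τ x y ∨ χ.link τ y x → χ.link τ x z ∨ χ.link τ z x → y = z) ∧
  -- at most one outgoing and one incoming link of the other types at a non-blank node
  (∀ τ, τ ≠ LinkType.K → τ ≠ LinkType.M → ∀ x, x ∉ χ.blankNodes → ∀ y z,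
    (χ.link τ x y → χ.link τ x z → y = z) ∧ (χ.link τ y x → χ.link τ z x → y = z)) ∧
  (∀ x y, χ.link .I x y → x ∈ χ.inputRegion ∧ y ∈ χ.inputRegion) ∧
  (∀ τ, τ = LinkType.h ∨ τ = LinkType.v ∨ τ = LinkType.d₁ ∨ τ = LinkType.d₂ → ∀ x y,
    χ.link τ x y → x ∈ χ.gridRegion ∧ y ∈ χ.gridRegion)

/-- Constraint C: any `K`-link is between `U_T̃` and `T̃`. -/
def ConstraintC : Prop :=
  ∀ x y, χ.link .K x y → x ∈ unloopedConn G χ.blankNodes ∧ y ∈ χ.blankNodes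

/-- Constraint D: `M`-links run between nodes in `L_T̃ ∪ T̃`. -/
def ConstraintD : Prop :=
  ∀ x y, χ.link .M x y →
    x ∈ loopedConn G χ.blankNodes ∪ χ.blankNodes ∧ y ∈ loopedConn G χ.blankNodes ∪ χ.blankNodes

/-- The number of blank edges lying in links of type `τ`. -/
noncomputable def blanksIn (τ : LinkType) : ℕ :=
  {e : V × V | χ.Blank e.1 e.2 ∧ (χ.link τ e.1 e.2 ∨ χ.link τ e.2 e.1)}.ncard

/-- `b̃_0, …, b̃_8`: the numbers of blank edges on `T̃`, and of types `h, v, d₁, d₂, K, I, M, C`.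
A `K`-link that is double blank is combined with a `C`-link: one of its two blanks counts
for `K`, the other one for `C`. -/
noncomputable def bTilde : Fin 9 → ℕ :=
  ![{e : V × V | e.1 ∈ χ.blankNodes ∧ e.2 ∈ χ.blankNodes ∧ χ.Blank e.1 e.2}.ncard,
    χ.blanksIn .h,
    χ.blanksIn .v,
    χ.blanksIn .d₁,
    χ.blanksIn .d₂,
    {e : V × V | χ.link .K e.1 e.2}.ncard,
    χ.blanksIn .I,
    χ.blanksIn .M,
    {e : V × V | ¬ Looped G e.1 ∧ e.2 ∈ χ.blankNodes ∧ Double G e.1 e.2 ∧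
      (χ.Blank e.1 e.2 ∨ χ.Blank e.2 e.1)}.ncard]

end TypedColoring

/-- `b_0, …, b_8`; the last one is the number of double edges between `U` and `T`. -/
noncomputable def bound {V : Type*} (G : Digraph V) (T : Set V) (p : ℕ) : Fin 9 → ℕ :=
  ![kOf p, 4 * p ^ 2, 8 * p ^ 2, 2 * p ^ 2, 2 * p ^ 2, 2 * p ^ 2, 4 * p ^ 2 - 1, 2 * p ^ 2 - 1,
    {e : V × V | ¬ Looped G e.1 ∧ e.2 ∈ T ∧ Double G e.1 e.2}.ncard]

/-- Every coloring of `G` that observes A–D and has `b̃ ≥ b` satisfies `T̃ = T`, `b̃_i ≤ b_i`, and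
hence `b̃_i = b_i`, for all `i`. -/
def BlanksForced {V : Type*} (G : Digraph V) (p : ℕ) : Prop :=
  ∀ T : Set V, IsTournament G T → T.ncard = kOf p →
    ∀ χ : TypedColoring G, χ.ConstraintA → χ.ConstraintB → χ.ConstraintC → χ.ConstraintD →
      ∑ i, bound G T p i ≤ ∑ i, χ.bTilde i →
        χ.blankNodes = T ∧ (∀ i, χ.bTilde i ≤ bound G T p i) ∧
          ∀ i, χ.bTilde i = bound G T p i

end GraphColoration

/-!
Choosing the adjacency bits independently and fairly makes all digraphs on the node set equally
likely, and cuts `𝒩_p` into cells according to `U` and `T`. A digraph is quasirandom if every node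
outside `U` has about `n / 4` double edges to `U`, and no `n / 100` nodes are all connected, or all
without a single edge, to the same `k / 2` nodes. In a quasirandom digraph of a cell the coloring
with `T̃ = T` is optimal: a tournament `T̃` other than `T` has fewer than `k` nodes, each missing
node costs about `n / 4` double edges, and this loss exceeds what the classes `U₀`, `U_T̃` and
`L_T̃` can gain.

A cell is not too unlikely. Prescribe the loops, the links within `T`, and double edges from `T` to
fixed sets `A ⊆ U` and `B`, all of which has probability `2 ^ (-O(k * 1.5 ^ k))` besides the loops.
The other nodes are then independent, and they all miss `U₀`, `U_T` and `L_T` with probability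
`exp(-O(1.5 ^ k))`. By the first moment method no second tournament of `k` nodes arises with
probability at least `1 / 2`: there `c = 10 + 1 / 6` enters, through `n ≤ 2 ^ (k - 10)`.
Quasirandomness fails with probability `exp(-Ω(n / k²))` independently of the loops, which is
negligible against the probability of the cell because `n / k²` is much larger than `k * 1.5 ^ k`.
-/

namespace GraphColoration

open MeasureTheory ProbabilityTheory

section FairBits

variable {ι κ : Type*}

/-- The law of independent fair bits indexed by a finite type `ι`. -/
noncomputable abbrev fairBits (ι : Type*) : Measure (ι → Bool) := uniformOn Set.univ

lemma dependsOn_mem_biInter {J : Finset κ} {A : κ → Set (ι → Bool)} {c : κ → Set ι}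
    (hA : ∀ j ∈ J, DependsOn (· ∈ A j) (c j)) :
    DependsOn (· ∈ ⋂ j ∈ J, A j) (⋃ j ∈ J, c j) := by
  intro ω ω' h
  simp only [Set.mem_iInter, eq_iff_iff]
  exact forall₂_congr fun j hj =>
    (hA j hj fun i hi => h i (Set.mem_biUnion hj hi)).to_iff

lemma dependsOn_forall_eq (J : Finset κ) (a : κ → ι) (b : κ → Bool) :
    DependsOn (· ∈ {ω : ι → Bool | ∀ j ∈ J, ω (a j) = b j}) (a '' J) := by
  intro ω ω' h
  simp only [Set.mem_ofPred_eq, eq_iff_iff]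
  exact forall₂_congr fun j hj => by rw [h (a j) ⟨j, hj, rfl⟩]

variable [Finite ι]

lemma fairBits_real_apply (A : Set (ι → Bool)) :
    (fairBits ι).real A = A.ncard / 2 ^ Nat.card ι := by
  classical
  have := Fintype.ofFinite ι
  rw [measureReal_def, uniformOn_univ, Measure.count_apply_finite _ A.toFinite, ENNReal.toReal_div,
    ← Set.ncard_eq_toFinset_card A]
  simp

lemma iIndepFun_fairBits : iIndepFun (fun i (ω : ι → Bool) => ω i) (fairBits ι) := by
  have := Fintype.ofFinite ι
  rw [fairBits, ← Set.pi_univ Set.univ, uniformOn_pi]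
  exact iIndepFun_pi (X := fun _ b => b) fun _ => aemeasurable_id

lemma fairBits_real_inter {A B : Set (ι → Bool)} {s t : Set ι} (hA : DependsOn (· ∈ A) s)
    (hB : DependsOn (· ∈ B) t) (hst : Disjoint s t) :
    (fairBits ι).real (A ∩ B) = (fairBits ι).real A * (fairBits ι).real B := by
  classical
  lift s to Finset ι using s.toFinite
  lift t to Finset ι using t.toFinite
  obtain ⟨f, hf⟩ := dependsOn_iff_exists_comp.1 hA
  obtain ⟨g, hg⟩ := dependsOn_iff_exists_comp.1 hB
  have indep := iIndepFun_fairBits.indepFun_finset s t (Finset.disjoint_coe.1 hst)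
    fun i => measurable_pi_apply i
  have hA' : A = (fun ω (i : s) => ω i) ⁻¹' {x | f x} := Set.ext fun ω => (congrFun hf ω).to_iff
  have hB' : B = (fun ω (i : t) => ω i) ⁻¹' {y | g y} := Set.ext fun ω => (congrFun hg ω).to_iff
  have h : fairBits ι (A ∩ B) = fairBits ι A * fairBits ι B := by
    rw [hA', hB']
    exact indep.measure_inter_preimage_eq_mul _ _ (Set.toFinite _).measurableSet
      (Set.toFinite _).measurableSet
  simp only [measureReal_def, h, ENNReal.toReal_mul]

lemma fairBits_real_biInter {J : Finset κ} {A : κ → Set (ι → Bool)} {c : κ → Set ι}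
    (hA : ∀ j ∈ J, DependsOn (· ∈ A j) (c j)) (hc : (J : Set κ).PairwiseDisjoint c) :
    (fairBits ι).real (⋂ j ∈ J, A j) = ∏ j ∈ J, (fairBits ι).real (A j) := by
  classical
  induction J using Finset.induction_on with
  | empty => simp
  | insert a J ha ih =>
    have hAJ : ∀ j ∈ J, DependsOn (· ∈ A j) (c j) := fun j hj => hA j (Finset.mem_insert_of_mem hj)
    rw [Finset.coe_insert, Set.pairwiseDisjoint_insert_of_notMem (by simpa using ha)] at hc
    rw [Finset.set_biInter_insert, Finset.prod_insert ha, ← ih hAJ hc.1]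
    exact fairBits_real_inter (hA a (Finset.mem_insert_self a J)) (dependsOn_mem_biInter hAJ)
      (by simpa using hc.2)

lemma fairBits_real_eq_bit (i : ι) (b : Bool) : (fairBits ι).real {ω | ω i = b} = 1 / 2 := by
  classical
  have := Fintype.ofFinite ι
  have h := measurePreserving_eval (fun _ : ι => (uniformOn Set.univ : Measure Bool)) i
  rw [← uniformOn_pi, Set.pi_univ] at h
  rw [measureReal_def,
    show {ω : ι → Bool | ω i = b} = Function.eval i ⁻¹' ({b} : Set Bool) from rfl,
    h.measure_preimage (MeasurableSet.singleton b).nullMeasurableSet, uniformOn_univ]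
  simp

lemma fairBits_real_forall_eq {J : Finset κ} {a : κ → ι} (ha : Set.InjOn a J) (b : κ → Bool) :
    (fairBits ι).real {ω | ∀ j ∈ J, ω (a j) = b j} = (1 / 2) ^ J.card := by
  have h : {ω : ι → Bool | ∀ j ∈ J, ω (a j) = b j} = ⋂ j ∈ J, {ω | ω (a j) = b j} := by
    ext; simp
  rw [h, fairBits_real_biInter (c := fun j => {a j}), Finset.prod_congr rfl fun j _ =>
    fairBits_real_eq_bit (a j) (b j), Finset.prod_const]
  · exact fun j _ ω ω' h => by simp [h (a j) rfl]
  · exact fun i hi j hj hij => by simpa using fun h => hij (ha hi hj h)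

lemma iIndepSet_fairBits {A : κ → Set (ι → Bool)} {c : κ → Set ι}
    (hA : ∀ j, DependsOn (· ∈ A j) (c j)) (hc : Pairwise (Function.onFun Disjoint c)) :
    iIndepSet A (fairBits ι) := by
  rw [iIndepSet_iff_meas_biInter fun j => (A j).toFinite.measurableSet]
  intro J
  have h := fairBits_real_biInter (fun j (_ : j ∈ J) => hA j) fun i _ j _ hij => hc hij
  simp only [measureReal_def, ← ENNReal.toReal_prod] at h
  exact (ENNReal.toReal_eq_toReal_iff' (by finiteness)
    (ENNReal.prod_ne_top fun j _ => by finiteness)).1 h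

end FairBits

section Hoeffding

variable {Ω κ : Type*} [MeasurableSpace Ω] {μ : Measure Ω} [IsProbabilityMeasure μ] [Finite κ]

lemma measureReal_le_abs_ncard_sub_le {A : κ → Set Ω} (hA : ∀ j, MeasurableSet (A j))
    (indep : iIndepSet A μ) {q : ℝ} (hq : ∀ j, μ.real (A j) = q) {ε : ℝ} (hε : 0 ≤ ε) :
    μ.real {ω | ε ≤ |({j | ω ∈ A j}.ncard : ℝ) - Nat.card κ * q|} ≤
      2 * Real.exp (-2 * ε ^ 2 / Nat.card κ) := by
  classical
  have := Fintype.ofFinite κ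
  let X : κ → Ω → ℝ := fun j ω => (A j).indicator 1 ω - q
  have subgaussian : ∀ j, HasSubgaussianMGF (X j) ((‖(1 : ℝ) - 0‖₊ / 2) ^ 2) μ := by
    intro j
    have h := hasSubgaussianMGF_of_mem_Icc (μ := μ) (X := (A j).indicator 1) (a := 0) (b := 1)
      ((measurable_const.indicator (hA j)).aemeasurable) (ae_of_all _ fun ω => by
        by_cases h : ω ∈ A j <;> simp [h])
    rwa [integral_indicator_one (hA j), hq j] at h
  have hsum : ∀ ω, ∑ j, X j ω = ({j | ω ∈ A j}.ncard : ℝ) - Nat.card κ * q := by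
    intro ω
    simp [X, Finset.sum_sub_distrib, Set.indicator_apply, Set.ncard_eq_toFinset_card']
  have total := HasSubgaussianMGF.sum_of_iIndepFun
    (indep.iIndepFun_indicator.comp (fun _ x => x - q) fun _ => measurable_id.sub_const q)
    (s := Finset.univ) fun j _ => subgaussian j
  have hsub : {ω | ε ≤ |({j | ω ∈ A j}.ncard : ℝ) - Nat.card κ * q|} ⊆
      {ω | ε ≤ ∑ j, X j ω} ∪ {ω | ε ≤ (-fun ω => ∑ j, X j ω) ω} := fun ω hω => by
    simpa [hsum, le_abs] using hω
  have value : -ε ^ 2 / (2 * ((∑ _j : κ, (‖(1 : ℝ) - 0‖₊ / 2) ^ 2 : NNReal) : ℝ)) =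
      -2 * ε ^ 2 / Nat.card κ := by
    simp only [sub_zero, nnnorm_one, Finset.sum_const, Finset.card_univ, ← Nat.card_eq_fintype_card,
      nsmul_eq_mul, NNReal.coe_mul, NNReal.coe_natCast, NNReal.coe_pow, NNReal.coe_div,
      NNReal.coe_one, NNReal.coe_ofNat]
    ring
  have upper := HasSubgaussianMGF.measure_ge_le total hε
  have lower := HasSubgaussianMGF.measure_ge_le (HasSubgaussianMGF.neg total) hε
  rw [value] at upper lower
  calc _ ≤ _ := measureReal_mono hsub
    _ ≤ _ := measureReal_union_le _ _
    _ ≤ _ := add_le_add upper lower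
    _ = _ := (two_mul _).symm

end Hoeffding

section Capacity

variable {V : Type*} (G : Digraph V)

/-- The double edges between un-looped nodes and `S`, as pairs `(u, s)`. For the `k`-node tournament
`T` of the paper their number is `b₈`. -/
def doubleEdges (S : Set V) : Set (V × V) :=
  {e | ¬ Looped G e.1 ∧ e.2 ∈ S ∧ Double G e.1 e.2}

/-- The upper bounds that constraints A–D put on the blank counts `b̃₀, …, b̃₈` of a coloring with
`T̃ = S`. For `S = T` these are the numbers `b₀, …, b₈`. -/
noncomputable def blankCapacity (S : Set V) : Fin 9 → ℕ :=
  ![S.ncard, 2 * (unloopedZero G S).ncard, 4 * (unloopedZero G S).ncard,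
    (unloopedZero G S).ncard, (unloopedZero G S).ncard, (unloopedConn G S).ncard,
    (unloopedConn G S).ncard + (loopedConn G S).ncard, (loopedConn G S).ncard,
    (doubleEdges G S).ncard]

lemma sum_blankCapacity (S : Set V) :
    ∑ i, blankCapacity G S i = S.ncard + 8 * (unloopedZero G S).ncard +
      2 * (unloopedConn G S).ncard + 2 * (loopedConn G S).ncard + (doubleEdges G S).ncard := by
  simp only [blankCapacity, Fin.sum_univ_succ, Fin.sum_univ_zero, Matrix.cons_val_zero,
    Matrix.cons_val_succ]
  ring

lemma bound_eq_blankCapacity {T : Set V} {p : ℕ} (hT : T.ncard = kOf p)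
    (hZero : (unloopedZero G T).ncard = 2 * p ^ 2) (hConn : (unloopedConn G T).ncard = 2 * p ^ 2)
    (hLooped : (loopedConn G T).ncard + 1 = 2 * p ^ 2) :
    bound G T p = blankCapacity G T := by
  have h₁ : 2 * (2 * p ^ 2) = 4 * p ^ 2 := by ring
  have h₂ : 4 * (2 * p ^ 2) = 8 * p ^ 2 := by ring
  have h₆ : 2 * p ^ 2 + (loopedConn G T).ncard = 4 * p ^ 2 - 1 := by omega
  have h₇ : (loopedConn G T).ncard = 2 * p ^ 2 - 1 := by omega
  rw [bound, blankCapacity, hT, hZero, hConn, h₆, h₇, h₁, h₂]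
  rfl

end Capacity

namespace TypedColoring

variable {V : Type*} {G : Digraph V} {χ : TypedColoring G}

lemma adj_of_blank {x y : V} (h : χ.Blank x y) : G.Adj x y := by
  by_contra hxy
  exact absurd (h.symm.trans ((χ.absent_iff x y).2 hxy)) (by simp)

lemma not_blank_of_color_eq {x y : V} {c : Color} (h : χ.color x y = c) (hc : c ≠ .blank) :
    ¬ χ.Blank x y := fun hb => hc (h.symm.trans hb)

lemma looped_of_mem_blankNodes {x : V} (hx : x ∈ χ.blankNodes) : Looped G x :=
  adj_of_blank hx

lemma notMem_blankNodes_of_not_looped {x : V} (hx : ¬ Looped G x) : x ∉ χ.blankNodes :=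
  mt looped_of_mem_blankNodes hx

lemma mem_unloopedZero_of_mem_gridRegion {x : V} (hx : x ∈ χ.gridRegion) (hl : ¬ Looped G x) :
    x ∈ unloopedZero G χ.blankNodes := by
  rcases hx with (hx | hx) | hx
  · exact hx
  · exact absurd hx.1 hl
  · exact absurd (looped_of_mem_blankNodes hx.1) hl

lemma ConstraintA.ncard_blank_edges_eq (hA : χ.ConstraintA) :
    {e : V × V | e.1 ∈ χ.blankNodes ∧ e.2 ∈ χ.blankNodes ∧ χ.Blank e.1 e.2}.ncard =
      χ.blankNodes.ncard := by
  have hdiag : {e : V × V | e.1 ∈ χ.blankNodes ∧ e.2 ∈ χ.blankNodes ∧ χ.Blank e.1 e.2} =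
      (fun x => (x, x)) '' χ.blankNodes := by
    ext ⟨x, y⟩
    constructor
    · rintro ⟨hx, hy, hb⟩
      obtain rfl : x = y := by
        by_contra hxy
        exact not_blank_of_color_eq (hA.2 x hx y hy hxy (adj_of_blank hb)) (by simp) hb
      exact ⟨x, hx, rfl⟩
    · rintro ⟨z, hz, he⟩
      obtain ⟨rfl, rfl⟩ := Prod.mk.inj he
      exact ⟨hz, hz, hz⟩
  rw [hdiag]
  exact Set.ncard_image_of_injective _ fun x y h => congrArg Prod.fst h

lemma blanksIn_eq_ncard_link {τ : LinkType}
    (hτ : ∀ x y, χ.link τ x y → χ.Blank x y ∧ ¬ χ.Blank y x) :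
    χ.blanksIn τ = {e : V × V | χ.link τ e.1 e.2}.ncard := by
  unfold blanksIn
  congr 1
  ext ⟨x, y⟩
  constructor
  · rintro ⟨hb, h | h⟩
    · exact h
    · exact absurd hb (hτ y x h).2
  · exact fun h => ⟨(hτ x y h).1, Or.inl h⟩

lemma ConstraintB.eq_of_link_M_incident (hB : χ.ConstraintB) {x y x' y' z : V}
    (h : χ.link .M x y) (h' : χ.link .M x' y') (hz : z ∉ χ.blankNodes)
    (hzxy : z = x ∨ z = y) (hzxy' : z = x' ∨ z = y') : (x, y) = (x', y') := by
  have unique := hB.1 .M (Or.inr rfl) z hz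
  rcases hzxy with rfl | rfl <;> rcases hzxy' with rfl | rfl
  · rw [unique _ _ (Or.inl h) (Or.inl h')]
  · obtain rfl := unique _ _ (Or.inl h) (Or.inr h')
    exact absurd h' (χ.directed _ _ _ _ h)
  · obtain rfl := unique _ _ (Or.inr h) (Or.inl h')
    exact absurd h' (χ.directed _ _ _ _ h)
  · rw [unique _ _ (Or.inr h) (Or.inr h')]

variable [Finite V]

lemma ConstraintB.ncard_link_from_unlooped_le (hB : χ.ConstraintB) {τ : LinkType}
    (hτ : τ = .h ∨ τ = .v ∨ τ = .d₁ ∨ τ = .d₂) :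
    {e : V × V | ¬ Looped G e.1 ∧ χ.link τ e.1 e.2}.ncard ≤
      (unloopedZero G χ.blankNodes).ncard := by
  refine Set.ncard_le_ncard_of_injOn Prod.fst ?_ ?_
  · rintro ⟨x, y⟩ ⟨hl, h⟩
    exact mem_unloopedZero_of_mem_gridRegion (hB.2.2.2 τ hτ x y h).1 hl
  · rintro ⟨x, y⟩ ⟨hl, h⟩ ⟨x', y'⟩ ⟨_, h'⟩ (rfl : x = x')
    rw [(hB.2.1 τ (by rintro rfl; simp at hτ) (by rintro rfl; simp at hτ) x
      (notMem_blankNodes_of_not_looped hl) y y').1 h h']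

lemma ConstraintB.ncard_link_to_unlooped_le (hB : χ.ConstraintB) {τ : LinkType}
    (hτ : τ = .h ∨ τ = .v ∨ τ = .d₁ ∨ τ = .d₂) :
    {e : V × V | ¬ Looped G e.2 ∧ χ.link τ e.1 e.2}.ncard ≤
      (unloopedZero G χ.blankNodes).ncard := by
  refine Set.ncard_le_ncard_of_injOn Prod.snd ?_ ?_
  · rintro ⟨x, y⟩ ⟨hl, h⟩
    exact mem_unloopedZero_of_mem_gridRegion (hB.2.2.2 τ hτ x y h).2 hl
  · rintro ⟨x, y⟩ ⟨hl, h⟩ ⟨x', y'⟩ ⟨_, h'⟩ (rfl : y = y')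
    rw [(hB.2.1 τ (by rintro rfl; simp at hτ) (by rintro rfl; simp at hτ) y
      (notMem_blankNodes_of_not_looped hl) x x').2 h h']

lemma ConstraintB.ncard_alternating_link_le (hB : χ.ConstraintB) {τ : LinkType}
    (hτ : τ = .h ∨ τ = .v) :
    {e : V × V | χ.link τ e.1 e.2}.ncard ≤ 2 * (unloopedZero G χ.blankNodes).ncard := by
  have hgrid : τ = .h ∨ τ = .v ∨ τ = .d₁ ∨ τ = .d₂ := by tauto
  have alternating : ∀ x y, χ.link τ x y → (Looped G x ↔ ¬ Looped G y) := by
    rcases hτ with rfl | rfl <;> exact fun x y h => (χ.pattern _ x y h).1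
  have hcover : {e : V × V | χ.link τ e.1 e.2} ⊆
      {e : V × V | ¬ Looped G e.1 ∧ χ.link τ e.1 e.2} ∪
        {e : V × V | ¬ Looped G e.2 ∧ χ.link τ e.1 e.2} := by
    rintro ⟨x, y⟩ h
    by_cases hx : Looped G x
    · exact Or.inr ⟨(alternating x y h).1 hx, h⟩
    · exact Or.inl ⟨hx, h⟩
  calc {e : V × V | χ.link τ e.1 e.2}.ncard
    _ ≤ _ := Set.ncard_le_ncard hcover
    _ ≤ _ := Set.ncard_union_le _ _
    _ ≤ (unloopedZero G χ.blankNodes).ncard + (unloopedZero G χ.blankNodes).ncard :=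
      add_le_add (hB.ncard_link_from_unlooped_le hgrid) (hB.ncard_link_to_unlooped_le hgrid)
    _ = 2 * (unloopedZero G χ.blankNodes).ncard := (two_mul _).symm

lemma ConstraintB.blanksIn_h_le (hB : χ.ConstraintB) :
    χ.blanksIn .h ≤ 2 * (unloopedZero G χ.blankNodes).ncard := by
  rw [blanksIn_eq_ncard_link (τ := .h) fun x y h => ⟨(χ.pattern _ x y h).2.1,
    not_blank_of_color_eq (χ.pattern _ x y h).2.2 (by simp)⟩]
  exact hB.ncard_alternating_link_le (Or.inl rfl)

lemma blanksIn_le_two_mul_ncard_link (τ : LinkType) :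
    χ.blanksIn τ ≤ 2 * {e : V × V | χ.link τ e.1 e.2}.ncard := by
  have hcover : {e : V × V | χ.Blank e.1 e.2 ∧ (χ.link τ e.1 e.2 ∨ χ.link τ e.2 e.1)} ⊆
      {e : V × V | χ.link τ e.1 e.2} ∪ Prod.swap '' {e : V × V | χ.link τ e.1 e.2} := by
    rintro ⟨x, y⟩ ⟨-, h | h⟩
    · exact Or.inl h
    · exact Or.inr ⟨(y, x), h, rfl⟩
  calc χ.blanksIn τ
    _ ≤ _ := Set.ncard_le_ncard hcover
    _ ≤ _ := Set.ncard_union_le _ _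
    _ = 2 * {e : V × V | χ.link τ e.1 e.2}.ncard := by
      rw [Set.ncard_image_of_injective _ Prod.swap_injective, two_mul]

lemma ConstraintB.blanksIn_v_le (hB : χ.ConstraintB) :
    χ.blanksIn .v ≤ 4 * (unloopedZero G χ.blankNodes).ncard := by
  have hlink := hB.ncard_alternating_link_le (τ := .v) (Or.inr rfl)
  have hblank := χ.blanksIn_le_two_mul_ncard_link .v
  omega

lemma ConstraintB.blanksIn_d_le (hB : χ.ConstraintB) {τ : LinkType} (hτ : τ = .d₁ ∨ τ = .d₂) :
    χ.blanksIn τ ≤ (unloopedZero G χ.blankNodes).ncard := by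
  have pattern : ∀ x y, χ.link τ x y → ¬ Looped G x ∧ χ.Blank x y ∧ ¬ χ.Blank y x := by
    rcases hτ with rfl | rfl <;> intro x y h <;> obtain ⟨hx, -, hxy, hyx⟩ := χ.pattern _ x y h <;>
      exact ⟨hx, hxy, not_blank_of_color_eq hyx (by simp)⟩
  calc χ.blanksIn τ
    _ = {e : V × V | χ.link τ e.1 e.2}.ncard :=
      blanksIn_eq_ncard_link fun x y h => (pattern x y h).2
    _ ≤ {e : V × V | ¬ Looped G e.1 ∧ χ.link τ e.1 e.2}.ncard :=
      Set.ncard_le_ncard fun e h => ⟨(pattern e.1 e.2 h).1, h⟩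
    _ ≤ (unloopedZero G χ.blankNodes).ncard := hB.ncard_link_from_unlooped_le (by tauto)

lemma ConstraintB.ncard_link_K_le (hB : χ.ConstraintB) (hC : χ.ConstraintC) :
    {e : V × V | χ.link .K e.1 e.2}.ncard ≤ (unloopedConn G χ.blankNodes).ncard := by
  refine Set.ncard_le_ncard_of_injOn Prod.fst (fun e h => (hC e.1 e.2 h).1) ?_
  rintro ⟨x, y⟩ h ⟨x', y'⟩ h' (rfl : x = x')
  rw [hB.1 .K (Or.inl rfl) x (notMem_blankNodes_of_not_looped (hC x y h).1.1) y y'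
    (Or.inl h) (Or.inl h')]

lemma ConstraintB.blanksIn_I_le (hB : χ.ConstraintB) :
    χ.blanksIn .I ≤ (unloopedConn G χ.blankNodes).ncard + (loopedConn G χ.blankNodes).ncard := by
  have backward : ∀ x y, χ.link .I x y → ¬ χ.Blank y x := fun x y h => by
    rcases (χ.pattern _ x y h).2.2.2 with h | h | h <;> exact not_blank_of_color_eq h (by simp)
  rw [blanksIn_eq_ncard_link (τ := .I) fun x y h => ⟨(χ.pattern _ x y h).2.2.1, backward x y h⟩]
  refine le_trans ?_ (Set.ncard_union_le _ _)
  refine Set.ncard_le_ncard_of_injOn Prod.snd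
    (fun e h => (hB.2.2.1 e.1 e.2 h).2.resolve_right (χ.pattern _ _ _ h).2.1) ?_
  rintro ⟨x, y⟩ h ⟨x', y'⟩ h' (rfl : y = y')
  rw [(hB.2.1 .I (by simp) (by simp) y (χ.pattern _ x y h).2.1 x x').2 h h']

lemma ConstraintB.blanksIn_M_le (hB : χ.ConstraintB) (hD : χ.ConstraintD) :
    χ.blanksIn .M ≤ (loopedConn G χ.blankNodes).ncard := by
  classical
  rw [blanksIn_eq_ncard_link (τ := .M) fun x y h => (χ.pattern _ x y h).2.2.2]
  -- Count an `M`-link at an endpoint outside `T̃`; no such node has two of them.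
  let endpoint : V × V → V := fun e => if e.1 ∈ χ.blankNodes then e.2 else e.1
  have endpoint_eq (e : V × V) : endpoint e = e.1 ∨ endpoint e = e.2 := by
    unfold endpoint; split_ifs <;> simp
  have endpoint_notMem (e : V × V) (h : χ.link .M e.1 e.2) : endpoint e ∉ χ.blankNodes := by
    unfold endpoint
    split_ifs with hx
    · exact fun hy => (χ.pattern _ _ _ h).2.2.1 ⟨hx, hy⟩
    · exact hx
  refine Set.ncard_le_ncard_of_injOn endpoint (fun e h => ?_) fun e h e' h' he => ?_
  · refine Or.resolve_right ?_ (endpoint_notMem e h)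
    rcases endpoint_eq e with he | he <;> rw [he]
    exacts [(hD _ _ h).1, (hD _ _ h).2]
  · exact hB.eq_of_link_M_incident h h' (endpoint_notMem e h) (endpoint_eq e)
      (he ▸ endpoint_eq e')

theorem bTilde_le_blankCapacity (hA : χ.ConstraintA) (hB : χ.ConstraintB) (hC : χ.ConstraintC)
    (hD : χ.ConstraintD) (i : Fin 9) : χ.bTilde i ≤ blankCapacity G χ.blankNodes i := by
  fin_cases i
  · exact hA.ncard_blank_edges_eq.le
  · exact hB.blanksIn_h_le
  · exact hB.blanksIn_v_le
  · exact hB.blanksIn_d_le (Or.inl rfl)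
  · exact hB.blanksIn_d_le (Or.inr rfl)
  · exact hB.ncard_link_K_le hC
  · exact hB.blanksIn_I_le
  · exact hB.blanksIn_M_le hD
  · exact Set.ncard_le_ncard fun e h => ⟨h.1, h.2.1, h.2.2.1⟩

end TypedColoring

section Tournaments

variable {V : Type*} {G : Digraph V} {S T : Set V}

lemma IsTournament.subset (hT : IsTournament G T) (h : S ⊆ T) : IsTournament G S :=
  ⟨fun x hx => hT.1 x (h hx), fun x hx y hy => hT.2.1 x (h hx) y (h hy),
    fun x hx y hy z hz => hT.2.2 x (h hx) y (h hy) z (h hz)⟩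

lemma IsTournament.subset_compl_unlooped (hS : IsTournament G S) : S ⊆ (unlooped G)ᶜ :=
  fun x hx h => h (hS.1 x hx)

/-- A larger tournament would contain another one of `k` nodes, obtained by exchanging a node of
`T` for a node outside `T`. -/
lemma IsTournament.ncard_lt_of_unique [Finite V] {k : ℕ} (hk : 0 < k)
    (hT : {S | IsTournament G S ∧ S.ncard = k} = {T}) (hS : IsTournament G S) (hST : S ≠ T) :
    S.ncard < k := by
  have unique : ∀ S' ⊆ S, S'.ncard = k → S' = T := fun S' h hS' =>
    hT.subset ⟨hS.subset h, hS'⟩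
  by_contra! hkS
  obtain ⟨T', hT'S, hT'⟩ := Set.exists_subset_card_eq hkS
  obtain rfl := unique T' hT'S hT'
  obtain ⟨y, hyS, hyT⟩ := Set.exists_of_ssubset (hT'S.ssubset_of_ne hST.symm)
  obtain ⟨x, hx⟩ : T'.Nonempty := Set.nonempty_of_ncard_ne_zero (by omega)
  have exchange : insert y (T' \ {x}) = T' := by
    refine unique _ (Set.insert_subset hyS (Set.sdiff_subset.trans hT'S)) ?_
    rw [Set.ncard_insert_of_notMem (fun h => hyT h.1), Set.ncard_sdiff_singleton_add_one hx, hT']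
  exact hyT (exchange ▸ Set.mem_insert y _)

end Tournaments

section Quasirandom

variable {V : Type*}

/-- Every set `W` of at least `n / 100` nodes contains a node in relation `R` to a node of `S`, for
all sets `S` of at least `k / 2` nodes that avoid `U` and `W`. -/
def LargeSetsRelated (R : V → V → Prop) (U : Set V) (n k : ℕ) : Prop :=
  ∀ S ⊆ Uᶜ, ∀ W, Disjoint W S → k ≤ 2 * S.ncard → n ≤ 100 * W.ncard → ∃ w ∈ W, ∃ s ∈ S, R w s

/-- The edges between the node set `U`, of about `n` nodes, and sets of about `k` nodes outside `U`
are distributed as in a random digraph. The numbers `16` and `100` are chosen such that the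
deviations add up to less than the `n / 4` double edges gained by enlarging a tournament by one
node. -/
structure Quasirandom (G : Digraph V) (U : Set V) (n k : ℕ) : Prop where
  double : ∀ x ∉ U, |({u ∈ U | Double G u x}.ncard : ℝ) - n / 4| ≤ n / (16 * k)
  not_connected : LargeSetsRelated (fun w s => ¬ Connected G w s) U n k
  single : LargeSetsRelated (fun w s => G.Adj w s ∧ ¬ G.Adj s w) U n k

lemma LargeSetsRelated.ncard_lt {R : V → V → Prop} {U S W : Set V} {n k : ℕ}
    (hR : LargeSetsRelated R U n k) (hS : S ⊆ Uᶜ) (hWS : Disjoint W S) (hk : k ≤ 2 * S.ncard)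
    (hW : ∀ w ∈ W, ∀ s ∈ S, ¬ R w s) : 100 * W.ncard < n := by
  by_contra! hn
  obtain ⟨w, hw, s, hs, hws⟩ := hR S hS W hWS hk hn
  exact hW w hw s hs hws

variable {G : Digraph V} {S T : Set V} {n k : ℕ}

lemma Quasirandom.ncard_classes_lt (hG : Quasirandom G (unlooped G) n k) (hS : IsTournament G S)
    (hk : k ≤ 2 * S.ncard) :
    100 * (unloopedZero G S).ncard < n ∧ 100 * (unloopedConn G S).ncard < n ∧
      100 * (loopedConn G S).ncard < n := by
  have hsub := hS.subset_compl_unlooped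
  refine ⟨hG.single.ncard_lt hsub ?_ hk fun w hw => hw.2,
    hG.not_connected.ncard_lt hsub ?_ hk fun w hw s hs => not_not.2 (hw.2 s hs),
    hG.not_connected.ncard_lt hsub ?_ hk fun w hw s hs => not_not.2 (hw.2.2 s hs)⟩
  · exact Set.disjoint_left.2 fun x hx hxS => hx.1 (hS.1 x hxS)
  · exact Set.disjoint_left.2 fun x hx hxS => hx.1 (hS.1 x hxS)
  · exact Set.disjoint_left.2 fun x hx => hx.2.1

variable [Finite V]

lemma ncard_doubleEdges (S : Set V) :
    (doubleEdges G S).ncard = ∑ x ∈ S.toFinite.toFinset, {u ∈ unlooped G | Double G u x}.ncard := by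
  classical
  have hmaps : Set.MapsTo Prod.snd ((doubleEdges G S).toFinite.toFinset : Set (V × V))
      S.toFinite.toFinset := fun e he => by
    simp only [Set.Finite.coe_toFinset] at he ⊢
    exact he.2.1
  rw [Set.ncard_eq_toFinset_card _, Finset.card_eq_sum_card_fiberwise hmaps]
  refine Finset.sum_congr rfl fun x hx => ?_
  have hfiber : (({e ∈ (doubleEdges G S).toFinite.toFinset | e.2 = x} : Finset (V × V)) :
      Set (V × V)) = (fun u => (u, x)) '' {u ∈ unlooped G | Double G u x} := by
    rw [Set.Finite.mem_toFinset] at hx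
    ext ⟨u, y⟩
    simp only [Finset.coe_filter, Set.Finite.mem_toFinset, Set.mem_ofPred_eq, Set.mem_image,
      Prod.mk.injEq, doubleEdges, unlooped]
    grind
  rw [← Set.ncard_coe_finset, hfiber]
  exact Set.ncard_image_of_injective _ fun u v h => congrArg Prod.fst h

lemma Quasirandom.abs_ncard_doubleEdges_sub_le (hG : Quasirandom G (unlooped G) n k)
    (hS : S ⊆ (unlooped G)ᶜ) :
    |((doubleEdges G S).ncard : ℝ) - S.ncard * (n / 4)| ≤ S.ncard * (n / (16 * k)) := by
  rw [ncard_doubleEdges, Set.ncard_eq_toFinset_card S, Nat.cast_sum, ← nsmul_eq_mul,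
    ← nsmul_eq_mul, ← Finset.sum_const, ← Finset.sum_const, ← Finset.sum_sub_distrib]
  refine (Finset.abs_sum_le_sum_abs _ _).trans (Finset.sum_le_sum fun x hx => ?_)
  exact hG.double x (hS ((Set.Finite.mem_toFinset _).1 hx))

lemma Quasirandom.ncard_doubleEdges_add_le (hG : Quasirandom G (unlooped G) n k) (hk : 0 < k)
    (hS : IsTournament G S) (hT : IsTournament G T) (hTk : T.ncard = k) (hSk : S.ncard ≤ k) :
    ((doubleEdges G S).ncard : ℝ) + (k - S.ncard) * (n / 4) ≤ (doubleEdges G T).ncard + n / 8 := by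
  have hSupper := (abs_le.1 (hG.abs_ncard_doubleEdges_sub_le hS.subset_compl_unlooped)).2
  have hTlower := (abs_le.1 (hG.abs_ncard_doubleEdges_sub_le hT.subset_compl_unlooped)).1
  have hdev : (k : ℝ) * (n / (16 * k)) = n / 16 := by field_simp
  have hSdev : (S.ncard : ℝ) * (n / (16 * k)) ≤ n / 16 := by
    rw [← hdev]; gcongr
  rw [hTk, hdev] at hTlower
  linarith

lemma ncard_unloopedZero_le (S : Set V) : (unloopedZero G S).ncard ≤ (unlooped G).ncard :=
  Set.ncard_le_ncard fun _ h => h.1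

lemma ncard_unloopedConn_le (S : Set V) : (unloopedConn G S).ncard ≤ (unlooped G).ncard :=
  Set.ncard_le_ncard fun _ h => h.1

lemma ncard_loopedConn_add_ncard_unlooped_le (S : Set V) :
    (loopedConn G S).ncard + (unlooped G).ncard ≤ Nat.card V := by
  have hdisj : Disjoint (loopedConn G S) (unlooped G) :=
    Set.disjoint_left.2 fun x hx hxU => hxU hx.1
  rw [← Set.ncard_union_eq hdisj, ← Set.ncard_univ]
  exact Set.ncard_le_ncard (Set.subset_univ _)

/-- If `S` has fewer than `k / 2` nodes, the missing double edges outweigh the trivial bounds on the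
node classes of `S`; otherwise these classes are small by quasirandomness. -/
lemma Quasirandom.sum_blankCapacity_lt (hG : Quasirandom G (unlooped G) n k) (hk : 200 ≤ k)
    (hn : 100 ≤ n) (hU : (unlooped G).ncard = n) (hV : Nat.card V ≤ 2 * n + k)
    (hS : IsTournament G S) (hT : IsTournament G T) (hTk : T.ncard = k) (hSk : S.ncard < k) :
    ∑ i, blankCapacity G S i < k + (doubleEdges G T).ncard := by
  have hdouble := hG.ncard_doubleEdges_add_le (by omega) hS hT hTk hSk.le
  rw [sum_blankCapacity]
  rify at hk hn hSk ⊢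
  rcases lt_or_ge (2 * S.ncard) k with hsmall | hlarge
  · have hZero := (ncard_unloopedZero_le (G := G) S).trans hU.le
    have hConn := (ncard_unloopedConn_le (G := G) S).trans hU.le
    have hLooped : (loopedConn G S).ncard ≤ n + k := by
      have := ncard_loopedConn_add_ncard_unlooped_le (G := G) S
      omega
    rify at hsmall hZero hConn hLooped
    nlinarith
  · obtain ⟨hZero, hConn, hLooped⟩ := hG.ncard_classes_lt hS hlarge
    have hgain : (n : ℝ) / 4 ≤ (k - S.ncard) * (n / 4) := by
      have : (S.ncard : ℝ) + 1 ≤ k := mod_cast Nat.succ_le_of_lt (by exact_mod_cast hSk)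
      exact le_mul_of_one_le_left (by positivity) (by linarith)
    rify at hZero hConn hLooped
    linarith

end Quasirandom

theorem blanksForced_of_quasirandom {V : Type*} [Finite V] {G : Digraph V} {T : Set V} {p : ℕ}
    (hV : Nat.card V ≤ 2 * nOf p + kOf p) (hk : 200 ≤ kOf p) (hn : 100 ≤ nOf p)
    (hT : {S | IsTournament G S ∧ S.ncard = kOf p} = {T}) (hU : (unlooped G).ncard = nOf p)
    (hZero : (unloopedZero G T).ncard = 2 * p ^ 2) (hConn : (unloopedConn G T).ncard = 2 * p ^ 2)
    (hLooped : (loopedConn G T).ncard + 1 = 2 * p ^ 2)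
    (hG : Quasirandom G (unlooped G) (nOf p) (kOf p)) : BlanksForced G p := by
  intro T' hT' hTk χ hA hB hC hD hsum
  obtain rfl : T' = T := hT.subset ⟨hT', hTk⟩
  have hbound := bound_eq_blankCapacity G hTk hZero hConn hLooped
  have hle := χ.bTilde_le_blankCapacity hA hB hC hD
  have hTeq : χ.blankNodes = T' := by
    by_contra hne
    have hlt := hG.sum_blankCapacity_lt hk hn hU hV hA.1 hT' hTk
      (hA.1.ncard_lt_of_unique (by omega) hT hne)
    have hmax : kOf p + (doubleEdges G T').ncard ≤ ∑ i, bound G T' p i := by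
      rw [hbound, sum_blankCapacity]; omega
    exact absurd (hlt.trans_le (hmax.trans hsum)) (Finset.sum_le_sum fun i _ => hle i).not_gt
  rw [hTeq, ← hbound] at hle
  refine ⟨hTeq, hle, fun i => ?_⟩
  exact (Finset.sum_eq_sum_iff_of_le fun i _ => hle i).1
    ((Finset.sum_le_sum fun i _ => hle i).antisymm hsum) i (Finset.mem_univ i)

section Quasirandom

variable {V : Type*} {G H : Digraph V} {R R' : V → V → Prop} {U : Set V} {n k : ℕ}

lemma LargeSetsRelated.mono (hR : LargeSetsRelated R U n k) (h : ∀ x y, x ≠ y → R x y → R' x y) :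
    LargeSetsRelated R' U n k := by
  intro S hS W hWS hk hn
  obtain ⟨w, hw, s, hs, hws⟩ := hR S hS W hWS hk hn
  exact ⟨w, hw, s, hs, h w s (hWS.ne_of_mem hw hs) hws⟩

/-- Quasirandomness does not see loops, because `U` avoids the sets `S` and the nodes `x`. -/
lemma Quasirandom.congr (hG : Quasirandom G U n k) (h : ∀ x y, x ≠ y → (G.Adj x y ↔ H.Adj x y)) :
    Quasirandom H U n k where
  double x hx := by
    have hdouble : {u ∈ U | Double H u x} = {u ∈ U | Double G u x} := Set.ext fun u =>
      and_congr_right fun hu =>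
        have hux : u ≠ x := ne_of_mem_of_not_mem hu hx
        (and_congr (h u x hux) (h x u hux.symm)).symm
    exact hdouble ▸ hG.double x hx
  not_connected := hG.not_connected.mono fun x y hxy =>
    mt (Or.imp (h x y hxy).2 (h y x hxy.symm).2)
  single := hG.single.mono fun x y hxy =>
    And.imp (h x y hxy).1 (mt (h y x hxy.symm).2)

/-- The digraph given by its adjacency bits. -/
def ofBits (ω : V × V → Bool) : Digraph V := ⟨fun x y => ω (x, y) = true⟩

lemma dependsOn_not_quasirandom :
    DependsOn (· ∈ {ω : V × V → Bool | ¬ Quasirandom (ofBits ω) U n k}) {e | e.1 ≠ e.2} := by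
  intro ω ω' h
  have hadj : ∀ x y, x ≠ y → ((ofBits ω).Adj x y ↔ (ofBits ω').Adj x y) := fun x y hxy => by
    simp only [ofBits, h (i := (x, y)) hxy]
  simp only [Set.mem_ofPred_eq, eq_iff_iff, not_iff_not]
  exact ⟨fun hω => hω.congr hadj, fun hω' => hω'.congr fun x y hxy => (hadj x y hxy).symm⟩

/-- The event that the edge `e` has bit `α` and the reversed edge has bit `β`. -/
def linkBits (α β : Bool) (e : V × V) : Set (V × V → Bool) := {ω | ω e = α ∧ ω e.swap = β}

lemma dependsOn_linkBits (α β : Bool) (e : V × V) :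
    DependsOn (· ∈ linkBits α β e) {e, e.swap} := by
  intro ω ω' h
  simp only [linkBits, Set.mem_ofPred_eq, h e (by simp), h e.swap (by simp)]

lemma dependsOn_linkBits_compl (α β : Bool) (e : V × V) :
    DependsOn (· ∈ (linkBits α β e)ᶜ) {e, e.swap} := by
  intro ω ω' h
  simp only [Set.mem_compl_iff, (dependsOn_linkBits α β e h).to_iff]

lemma pairwiseDisjoint_pair_swap {E : Set (V × V)} (hE : ∀ e ∈ E, e.swap ∉ E) :
    E.PairwiseDisjoint fun e => ({e, e.swap} : Set (V × V)) := by
  intro e he f hf hef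
  rw [Function.onFun, Set.disjoint_left]
  rintro g (rfl | rfl) (h | h)
  · exact hef h
  · exact hE f hf (h ▸ he)
  · exact hE e he (h ▸ hf)
  · exact hef (Prod.swap_injective h)

lemma not_connected_ofBits_iff {ω : V × V → Bool} {x y : V} :
    ¬ Connected (ofBits ω) x y ↔ ω ∈ linkBits false false (x, y) := by
  simp [Connected, ofBits, linkBits]

lemma single_ofBits_iff {ω : V × V → Bool} {x y : V} :
    (ofBits ω).Adj x y ∧ ¬ (ofBits ω).Adj y x ↔ ω ∈ linkBits true false (x, y) := by
  simp [ofBits, linkBits]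

lemma double_ofBits_iff {ω : V × V → Bool} {x y : V} :
    Double (ofBits ω) x y ↔ ω ∈ linkBits true true (x, y) := by
  simp [Double, ofBits, linkBits]

variable [Finite V]

lemma fairBits_real_linkBits (α β : Bool) {e : V × V} (he : e.1 ≠ e.2) :
    (fairBits (V × V)).real (linkBits α β e) = 1 / 4 := by
  have hne : e ≠ e.swap := fun h => he (congrArg Prod.fst h)
  have h := fairBits_real_inter (A := {ω : V × V → Bool | ω e = α}) (B := {ω | ω e.swap = β})
    (s := {e}) (t := {e.swap}) (fun ω ω' h => by simp [h e rfl])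
    (fun ω ω' h => by simp [h e.swap rfl]) (by simpa using hne)
  rw [linkBits, Set.ofPred_and, h, fairBits_real_eq_bit, fairBits_real_eq_bit]
  norm_num

lemma fairBits_real_biInter_linkBits_compl (α β : Bool) {E : Finset (V × V)}
    (hE : ∀ e ∈ E, e.swap ∉ E) :
    (fairBits (V × V)).real (⋂ e ∈ E, (linkBits α β e)ᶜ) = (3 / 4) ^ E.card := by
  rw [fairBits_real_biInter (fun e _ => dependsOn_linkBits_compl α β e)
    (pairwiseDisjoint_pair_swap (by simpa using hE)), ← Finset.prod_const]
  refine Finset.prod_congr rfl fun e he => ?_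
  have hne : e.1 ≠ e.2 := fun h => hE e he (by rwa [← Prod.mk.eta (p := e), h] at he ⊢)
  rw [probReal_compl_eq_one_sub (Set.toFinite _).measurableSet, fairBits_real_linkBits α β hne]
  norm_num

lemma fairBits_real_not_largeSetsRelated_le (α β : Bool) (U : Set V) (n k : ℕ) :
    (fairBits (V × V)).real {ω | ¬ LargeSetsRelated (fun w s => ω ∈ linkBits α β (w, s)) U n k} ≤
      4 ^ Nat.card V * (3 / 4) ^ (k * n / 200) := by
  classical
  have := Fintype.ofFinite V
  let J : Finset (Finset V × Finset V) :=
    {p | Disjoint p.2 p.1 ∧ k ≤ 2 * p.1.card ∧ n ≤ 100 * p.2.card}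
  let A : Finset V × Finset V → Set (V × V → Bool) :=
    fun p => ⋂ e ∈ p.2 ×ˢ p.1, (linkBits α β e)ᶜ
  have hsub : {ω : V × V → Bool | ¬ LargeSetsRelated (fun w s => ω ∈ linkBits α β (w, s)) U n k} ⊆
      ⋃ p ∈ J, A p := by
    intro ω hω
    simp only [LargeSetsRelated, Set.mem_ofPred_eq, not_forall, not_exists, not_and] at hω
    obtain ⟨S, -, W, hWS, hk, hn, hnone⟩ := hω
    rw [Set.ncard_eq_toFinset_card'] at hk hn
    simp only [Set.mem_iUnion]
    refine ⟨(S.toFinset, W.toFinset), Finset.mem_filter.2 ⟨Finset.mem_univ _, ?_, hk, hn⟩, ?_⟩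
    · simpa using hWS
    · simpa [A] using fun w s hw hs => hnone w hw s hs
  have hA : ∀ p ∈ J, (fairBits (V × V)).real (A p) ≤ (3 / 4) ^ (k * n / 200) := by
    intro p hp
    obtain ⟨hdisj, hk, hn⟩ := (Finset.mem_filter.1 hp).2
    rw [fairBits_real_biInter_linkBits_compl α β, Finset.card_product]
    · refine pow_le_pow_of_le_one (by norm_num) (by norm_num) ?_
      have := Nat.mul_le_mul hk hn
      lia
    · rintro ⟨w, s⟩ he he'
      exact Finset.disjoint_left.1 hdisj (Finset.mem_product.1 he).1 (Finset.mem_product.1 he').2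
  have hJ : J.card ≤ 4 ^ Nat.card V := by
    refine (Finset.card_le_univ J).trans_eq ?_
    rw [Fintype.card_prod, Fintype.card_finset, ← mul_pow, Nat.card_eq_fintype_card]
    norm_num
  calc _ ≤ _ := measureReal_mono hsub (measure_ne_top _ _)
    _ ≤ ∑ p ∈ J, (fairBits (V × V)).real (A p) := measureReal_biUnion_finset_le J A
    _ ≤ J.card * (3 / 4 : ℝ) ^ (k * n / 200) := by
      simpa using Finset.sum_le_card_nsmul J _ _ hA
    _ ≤ _ := by gcongr; exact_mod_cast hJ

lemma fairBits_real_lt_abs_double_sub_le {U : Set V} {x : V} (hx : x ∉ U) (k : ℕ) :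
    (fairBits (V × V)).real {ω | (U.ncard : ℝ) / (16 * k) <
        |({u ∈ U | Double (ofBits ω) u x}.ncard : ℝ) - U.ncard / 4|} ≤
      2 * Real.exp (-U.ncard / (128 * k ^ 2)) := by
  let A : U → Set (V × V → Bool) := fun u => linkBits true true (↑u, x)
  have hne : ∀ u : U, (u : V) ≠ x := fun u => ne_of_mem_of_not_mem u.2 hx
  have indep : iIndepSet A (fairBits (V × V)) :=
    iIndepSet_fairBits (fun u => dependsOn_linkBits true true (↑u, x)) fun u v huv =>
      pairwiseDisjoint_pair_swap (E := {e | e.1 ∈ U ∧ e.2 = x})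
        (fun e he he' => hx (he.2 ▸ he'.1)) ⟨u.2, rfl⟩ ⟨v.2, rfl⟩
        fun h => huv (Subtype.ext (congrArg Prod.fst (h : ((u : V), x) = (↑v, x))))
  have hcount : ∀ ω, {u | ω ∈ A u}.ncard = {u ∈ U | Double (ofBits ω) u x}.ncard := by
    intro ω
    rw [← Set.ncard_image_of_injective _ Subtype.val_injective]
    congr 1
    ext u
    simp [A, double_ofBits_iff, and_comm]
  have hoeffding := measureReal_le_abs_ncard_sub_le (fun u => (A u).toFinite.measurableSet) indep
    (fun u => fairBits_real_linkBits true true (hne u)) (ε := U.ncard / (16 * k)) (by positivity)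
  simp only [hcount, Nat.card_coe_set_eq] at hoeffding
  calc _ ≤ _ := measureReal_mono fun ω hω => by
        simpa [mul_one_div] using (show _ < _ from hω).le
    _ ≤ _ := hoeffding
    _ = _ := by
      congr 2
      rcases eq_or_ne (U.ncard : ℝ) 0 with h | h
      · simp [h]
      · field_simp
        norm_num

theorem fairBits_real_not_quasirandom_le (U : Set V) (k : ℕ) :
    (fairBits (V × V)).real {ω | ¬ Quasirandom (ofBits ω) U U.ncard k} ≤
      Nat.card V * (2 * Real.exp (-U.ncard / (128 * k ^ 2))) +
        2 * (4 ^ Nat.card V * (3 / 4) ^ (k * U.ncard / 200)) := by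
  classical
  have := Fintype.ofFinite V
  let deviates : V → Set (V × V → Bool) := fun x => {ω | (U.ncard : ℝ) / (16 * k) <
    |({u ∈ U | Double (ofBits ω) u x}.ncard : ℝ) - U.ncard / 4|}
  let unrelated : Bool → Set (V × V → Bool) := fun α =>
    {ω | ¬ LargeSetsRelated (fun w s => ω ∈ linkBits α false (w, s)) U U.ncard k}
  have hsub : {ω : V × V → Bool | ¬ Quasirandom (ofBits ω) U U.ncard k} ⊆
      (⋃ x ∈ Uᶜ.toFinset, deviates x) ∪ (unrelated false ∪ unrelated true) := by
    intro ω hω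
    contrapose! hω
    simp only [Set.mem_union, Set.mem_iUnion, not_or, not_exists, Set.mem_toFinset, deviates,
      unrelated, Set.mem_ofPred_eq, not_lt, not_not] at hω ⊢
    exact ⟨hω.1, hω.2.1.mono fun _ _ _ => not_connected_ofBits_iff.2,
      hω.2.2.mono fun _ _ _ => single_ofBits_iff.2⟩
  have hdeviates : (fairBits (V × V)).real (⋃ x ∈ Uᶜ.toFinset, deviates x) ≤
      Nat.card V * (2 * Real.exp (-U.ncard / (128 * k ^ 2))) := by
    refine (measureReal_biUnion_finset_le _ _).trans ((Finset.sum_le_card_nsmul _ _ _ fun x hx =>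
      fairBits_real_lt_abs_double_sub_le (by simpa using hx) k).trans ?_)
    rw [nsmul_eq_mul, Nat.card_eq_fintype_card]
    gcongr
    exact Finset.card_le_univ _
  calc _ ≤ _ := measureReal_mono hsub (measure_ne_top _ _)
    _ ≤ _ := measureReal_union_le _ _
    _ ≤ _ := add_le_add hdeviates ((measureReal_union_le _ _).trans (add_le_add
      (fairBits_real_not_largeSetsRelated_le false false U U.ncard k)
      (fairBits_real_not_largeSetsRelated_le true false U U.ncard k)))
    _ = _ := by rw [two_mul (4 ^ Nat.card V * _)]

end Quasirandom

section Tournament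

variable {V ι : Type*} {G : Digraph V}

lemma isTournament_range [LinearOrder ι] {f : ι ↪ V} (hf : ∀ i j, G.Adj (f i) (f j) ↔ i ≤ j) :
    IsTournament G (Set.range f) := by
  refine ⟨?_, ?_, ?_⟩
  · rintro _ ⟨i, rfl⟩
    exact (hf i i).2 le_rfl
  · rintro _ ⟨i, rfl⟩ _ ⟨j, rfl⟩ hij
    rw [hf, hf, not_le]
    exact (ne_of_apply_ne f hij).le_iff_lt
  · rintro _ ⟨i, rfl⟩ _ ⟨j, rfl⟩ _ ⟨l, rfl⟩
    rw [hf, hf, hf]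
    exact le_trans

lemma IsTournament.exists_enum [Finite V] {S : Set V} (hS : IsTournament G S) :
    ∃ f : Fin S.ncard ↪ V, Set.range f = S ∧ ∀ i j, G.Adj (f i) (f j) ↔ i ≤ j := by
  classical
  let _ : LinearOrder S :=
    { le := fun x y => G.Adj x y
      le_refl := fun x => hS.1 x x.2
      le_trans := fun x y z => hS.2.2 x x.2 y y.2 z z.2
      le_antisymm := fun x y hxy hyx => by
        by_contra hne
        exact (hS.2.1 x x.2 y y.2 (Subtype.coe_ne_coe.2 hne)).1 hxy hyx
      le_total := fun x y => by
        rcases eq_or_ne x y with rfl | hne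
        · exact Or.inl (hS.1 x x.2)
        · have := hS.2.1 x x.2 y y.2 (Subtype.coe_ne_coe.2 hne)
          tauto
      toDecidableLE := Classical.decRel _ }
  have := Fintype.ofFinite S
  let e := Fintype.orderIsoFinOfCardEq S (k := S.ncard)
    (by rw [← Nat.card_coe_set_eq, Nat.card_eq_fintype_card])
  refine ⟨e.toEquiv.toEmbedding.trans (.subtype _), ?_, fun i j => e.le_iff_le⟩
  rw [Function.Embedding.coe_trans, Set.range_comp]
  simp

end Tournament

/-- The data of a tournament planted in a random digraph: its nodes in order, the set `U` of
un-looped nodes, and the sets `A` of un-looped and `B` of looped nodes that are joined to all of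
the tournament by double edges. -/
structure Planting (V : Type*) (k : ℕ) where
  node : Fin k ↪ V
  U : Finset V
  A : Finset V
  B : Finset V
  A_subset : A ⊆ U
  B_disjoint : Disjoint B U
  node_notMem_U : ∀ i, node i ∉ U
  node_notMem_B : ∀ i, node i ∉ B

namespace Planting

section NodeSets

variable {V : Type*} {k : ℕ} (Q : Planting V k)

/-- The node set of the planted tournament. -/
def T : Finset V := Finset.univ.map Q.node

lemma mem_T {x : V} : x ∈ Q.T ↔ ∃ i, Q.node i = x := by simp [T]

lemma coe_T : (Q.T : Set V) = Set.range Q.node := by simp [T]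

lemma node_mem_T (i : Fin k) : Q.node i ∈ Q.T := Q.mem_T.2 ⟨i, rfl⟩

lemma card_T : Q.T.card = k := by simp [T]

lemma notMem_U_of_mem_T {x : V} (hx : x ∈ Q.T) : x ∉ Q.U := by
  obtain ⟨i, rfl⟩ := Q.mem_T.1 hx
  exact Q.node_notMem_U i

/-- The event that `y` is unconnected to some node of the tournament and sends a single edge to
some node of it. -/
def loose (y : V) : Set (V × V → Bool) :=
  (⋃ t ∈ Q.T, linkBits false false (y, t)) ∩ ⋃ t ∈ Q.T, linkBits true false (y, t)

/-- The node pairs between `y` and the tournament. -/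
def pairsAt (y : V) : Set (V × V) := {e | e ∈ {y} ×ˢ Q.T ∨ e ∈ Q.T ×ˢ {y}}

lemma dependsOn_loose (y : V) : DependsOn (· ∈ Q.loose y) (Q.pairsAt y) := by
  intro ω ω' h
  have hout : ∀ t ∈ Q.T, ω (y, t) = ω' (y, t) := fun t ht => h _ (by simp [pairsAt, ht])
  have hin : ∀ t ∈ Q.T, ω (t, y) = ω' (t, y) := fun t ht => h _ (by simp [pairsAt, ht])
  simp only [loose, linkBits, Set.mem_inter_iff, Set.mem_iUnion, Set.mem_ofPred_eq, exists_prop,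
    Prod.swap_prod_mk, eq_iff_iff]
  refine and_congr (exists_congr fun t => and_congr_right fun ht => ?_)
    (exists_congr fun t => and_congr_right fun ht => ?_) <;>
  rw [hout t ht, hin t ht]

lemma dependsOn_iInter_loose (Y : Finset V) :
    DependsOn (· ∈ ⋂ y ∈ Y, Q.loose y) (⋃ y ∈ Y, Q.pairsAt y) :=
  dependsOn_mem_biInter fun y _ => Q.dependsOn_loose y

lemma fairBits_real_loose_compl_le [Finite V] {y : V} (hy : y ∉ Q.T) :
    (fairBits (V × V)).real (Q.loose y)ᶜ ≤ 2 * (3 / 4) ^ k := by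
  classical
  have hswap : ∀ e ∈ ({y} ×ˢ Q.T : Finset (V × V)), e.swap ∉ ({y} ×ˢ Q.T : Finset (V × V)) := by
    rintro ⟨a, b⟩ hab hba
    simp only [Prod.swap_prod_mk, Finset.mem_product, Finset.mem_singleton] at hab hba
    exact hy (hba.1 ▸ hab.2)
  have hcompl : (Q.loose y)ᶜ = (⋂ e ∈ ({y} ×ˢ Q.T : Finset (V × V)), (linkBits false false e)ᶜ) ∪
      ⋂ e ∈ ({y} ×ˢ Q.T : Finset (V × V)), (linkBits true false e)ᶜ := by
    ext ω
    simp [loose, imp_iff_not_or]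
  calc (fairBits (V × V)).real (Q.loose y)ᶜ ≤ (3 / 4) ^ k + (3 / 4) ^ k := by
        rw [hcompl]
        refine (measureReal_union_le _ _).trans_eq ?_
        rw [fairBits_real_biInter_linkBits_compl _ _ hswap,
          fairBits_real_biInter_linkBits_compl _ _ hswap, Finset.card_product,
          Finset.card_singleton, one_mul, card_T]
    _ = 2 * (3 / 4) ^ k := (two_mul _).symm

variable [DecidableEq V]

/-- The nodes whose links to the tournament are prescribed. -/
def D : Finset V := Q.A ∪ Q.B

lemma notMem_D_of_mem_T {x : V} (hx : x ∈ Q.T) : x ∉ Q.D := by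
  obtain ⟨i, rfl⟩ := Q.mem_T.1 hx
  exact Finset.notMem_union.2
    ⟨fun hA => Q.node_notMem_U i (Q.A_subset hA), Q.node_notMem_B i⟩

lemma notMem_D_of_mem_U {x : V} (hU : x ∈ Q.U) (hA : x ∉ Q.A) : x ∉ Q.D :=
  Finset.notMem_union.2 ⟨hA, fun hB => Finset.disjoint_left.1 Q.B_disjoint hB hU⟩

lemma notMem_D_of_notMem_U {x : V} (hU : x ∉ Q.U) (hB : x ∉ Q.B) : x ∉ Q.D :=
  Finset.notMem_union.2 ⟨fun hA => hU (Q.A_subset hA), hB⟩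

variable [Fintype V]

/-- The nodes whose links to the tournament are not prescribed. -/
def rest : Finset V := (Q.T ∪ Q.D)ᶜ

lemma mem_rest {x : V} : x ∈ Q.rest ↔ x ∉ Q.T ∧ x ∉ Q.D := by simp [rest]

end NodeSets

section Events

variable {V : Type*} [Fintype V] [DecidableEq V] {k : ℕ} (Q : Planting V k)

/-- The node pairs with a prescribed adjacency bit. -/
def fixedPairs : Finset (V × V) :=
  {e | e.1 = e.2 ∨ e ∈ Q.T ×ˢ Q.T ∨ e ∈ Q.D ×ˢ Q.T ∨ e ∈ Q.T ×ˢ Q.D}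

open Classical in
/-- The prescribed adjacency bits; the second condition is void on pairs that leave the
tournament. -/
noncomputable def fixedBit (e : V × V) : Bool :=
  decide ((e.1 = e.2 → e.1 ∉ Q.U) ∧ ∀ i j, Q.node i = e.1 → Q.node j = e.2 → i ≤ j)

/-- The event that all prescribed bits occur. -/
def fixed : Set (V × V → Bool) := {ω | ∀ e ∈ Q.fixedPairs, ω e = Q.fixedBit e}

/-- The event that the prescribed bits occur and that no further node is joined to all of the
tournament. -/
def planted : Set (V × V → Bool) := Q.fixed ∩ ⋂ y ∈ Q.rest, Q.loose y

lemma card_fixedPairs_le :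
    Q.fixedPairs.card ≤ Fintype.card V + k ^ 2 + 2 * k * Q.D.card := by
  have hsub : Q.fixedPairs ⊆
      Finset.univ.diag ∪ (Q.T ×ˢ Q.T ∪ (Q.D ×ˢ Q.T ∪ Q.T ×ˢ Q.D)) := by
    intro e he
    simpa [fixedPairs] using he
  calc Q.fixedPairs.card
      ≤ (Finset.univ.diag : Finset (V × V)).card +
          ((Q.T ×ˢ Q.T).card + ((Q.D ×ˢ Q.T).card + (Q.T ×ˢ Q.D).card)) :=
        (Finset.card_le_card hsub).trans <| (Finset.card_union_le _ _).trans <|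
          add_le_add_right ((Finset.card_union_le _ _).trans <|
            add_le_add_right (Finset.card_union_le _ _) _) _
    _ = Fintype.card V + k ^ 2 + 2 * k * Q.D.card := by
        simp only [Finset.diag_card, Finset.card_univ, Finset.card_product, card_T]
        ring

lemma dependsOn_fixed : DependsOn (· ∈ Q.fixed) (Q.fixedPairs : Set (V × V)) := by
  have h := dependsOn_forall_eq Q.fixedPairs id Q.fixedBit
  rw [Set.image_id] at h
  exact h

lemma pairwiseDisjoint_pairsAt : (Q.rest : Set V).PairwiseDisjoint Q.pairsAt := by
  intro x hx y _ hxy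
  have hxT := (Q.mem_rest.1 hx).1
  rw [Function.onFun, Set.disjoint_left]
  rintro ⟨a, b⟩ hab hab'
  simp only [pairsAt, Finset.mem_product, Finset.mem_singleton, Set.mem_ofPred_eq] at hab hab'
  grind

lemma disjoint_fixedPairs_pairsAt {y : V} (hy : y ∈ Q.rest) :
    Disjoint (Q.fixedPairs : Set (V × V)) (Q.pairsAt y) := by
  obtain ⟨hyT, hyD⟩ := Q.mem_rest.1 hy
  rw [Set.disjoint_left]
  rintro ⟨a, b⟩ hab hab'
  simp only [fixedPairs, pairsAt, Finset.mem_product, Finset.mem_singleton, Set.mem_ofPred_eq,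
    Finset.coe_filter, Finset.mem_univ, true_and] at hab hab'
  grind

lemma fairBits_real_iInter_loose {Y : Finset V} (hY : Y ⊆ Q.rest) :
    (fairBits (V × V)).real (⋂ y ∈ Y, Q.loose y) =
      ∏ y ∈ Y, (fairBits (V × V)).real (Q.loose y) :=
  fairBits_real_biInter (fun y _ => Q.dependsOn_loose y)
    (Q.pairwiseDisjoint_pairsAt.subset (Finset.coe_subset.2 hY))

lemma fairBits_real_fixed_inter {Y : Finset V} (hY : Y ⊆ Q.rest) :
    (fairBits (V × V)).real (Q.fixed ∩ ⋂ y ∈ Y, Q.loose y) =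
      (fairBits (V × V)).real Q.fixed * (fairBits (V × V)).real (⋂ y ∈ Y, Q.loose y) :=
  fairBits_real_inter Q.dependsOn_fixed (Q.dependsOn_iInter_loose Y)
    (Set.disjoint_iUnion₂_right.2 fun _ hy => Q.disjoint_fixedPairs_pairsAt (hY hy))

lemma le_fairBits_real_fixed :
    (1 / 2) ^ (Fintype.card V + k ^ 2 + 2 * k * Q.D.card) ≤ (fairBits (V × V)).real Q.fixed := by
  have h : (fairBits (V × V)).real Q.fixed = (1 / 2) ^ Q.fixedPairs.card :=
    fairBits_real_forall_eq (a := id) Function.injective_id.injOn Q.fixedBit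
  rw [h]
  exact pow_le_pow_of_le_one (by norm_num) (by norm_num) Q.card_fixedPairs_le

lemma le_fairBits_real_iInter_loose (hk : 2 * (3 / 4 : ℝ) ^ k ≤ 1) :
    (1 - 2 * (3 / 4) ^ k) ^ Fintype.card V ≤
      (fairBits (V × V)).real (⋂ y ∈ Q.rest, Q.loose y) := by
  have hq : (0 : ℝ) ≤ (3 / 4) ^ k := by positivity
  rw [Q.fairBits_real_iInter_loose subset_rfl]
  calc (1 - 2 * (3 / 4 : ℝ) ^ k) ^ Fintype.card V
      ≤ (1 - 2 * (3 / 4 : ℝ) ^ k) ^ Q.rest.card :=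
        pow_le_pow_of_le_one (by linarith) (by linarith) (Finset.card_le_univ _)
    _ = ∏ _y ∈ Q.rest, (1 - 2 * (3 / 4 : ℝ) ^ k) := by rw [Finset.prod_const]
    _ ≤ ∏ y ∈ Q.rest, (fairBits (V × V)).real (Q.loose y) := by
        refine Finset.prod_le_prod (fun _ _ => by linarith) fun y hy => ?_
        have hloose := Q.fairBits_real_loose_compl_le (Q.mem_rest.1 hy).1
        rw [probReal_compl_eq_one_sub (Set.toFinite _).measurableSet] at hloose
        linarith

lemma le_fairBits_real_planted (hk : 2 * (3 / 4 : ℝ) ^ k ≤ 1) :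
    (1 / 2 : ℝ) ^ (Fintype.card V + k ^ 2 + 2 * k * Q.D.card) *
      (1 - 2 * (3 / 4) ^ k) ^ Fintype.card V ≤ (fairBits (V × V)).real Q.planted := by
  rw [planted, Q.fairBits_real_fixed_inter subset_rfl]
  exact mul_le_mul Q.le_fairBits_real_fixed (Q.le_fairBits_real_iInter_loose hk)
    (pow_nonneg (by linarith) _) measureReal_nonneg

end Events

section Chain

variable {V : Type*} {k : ℕ}

/-- The pairs of distinct positions that are not both in `P`: a candidate reads fresh adjacency
bits there, whereas on `P` it repeats bits of the planted tournament. -/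
def freshPairs (P : Finset (Fin k)) : Finset (Fin k × Fin k) :=
  Finset.univ.offDiag \ P.offDiag

/-- The event that the adjacency bits of `f` on the fresh pairs are those of a tournament
enumerated by `f`. -/
def chain (P : Finset (Fin k)) (f : Fin k → V) : Set (V × V → Bool) :=
  {ω | ∀ e ∈ freshPairs P, ω (Prod.map f f e) = decide (e.1 ≤ e.2)}

lemma mem_freshPairs {P : Finset (Fin k)} {e : Fin k × Fin k} :
    e ∈ freshPairs P ↔ e.1 ≠ e.2 ∧ ¬ (e.1 ∈ P ∧ e.2 ∈ P) := by
  simp only [freshPairs, Finset.mem_sdiff, Finset.mem_offDiag, Finset.mem_univ, true_and]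
  tauto

lemma card_freshPairs {P : Finset (Fin k)} {r : ℕ} (hr : P.card + r = k) :
    (freshPairs P).card + r = r * (2 * P.card + r) := by
  have h := Finset.card_sdiff_add_card_eq_card (Finset.offDiag_mono (Finset.subset_univ P))
  rw [← freshPairs, Finset.offDiag_card, Finset.offDiag_card, Finset.card_univ,
    Fintype.card_fin] at h
  have hP : P.card ≤ P.card * P.card := Nat.le_mul_self _
  have hk : k ≤ k * k := Nat.le_mul_self _
  zify [hP, hk] at h ⊢
  have hr' : (k : ℤ) = P.card + r := by exact_mod_cast hr.symm
  rw [hr'] at h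
  linarith

lemma dependsOn_chain (P : Finset (Fin k)) (f : Fin k → V) :
    DependsOn (· ∈ chain P f) (Prod.map f f '' freshPairs P) :=
  dependsOn_forall_eq _ _ _

lemma fairBits_real_chain [Finite V] (P : Finset (Fin k)) (f : Fin k ↪ V) :
    (fairBits (V × V)).real (chain P f) = (1 / 2) ^ (freshPairs P).card :=
  fairBits_real_forall_eq (a := Prod.map f f) (f.injective.prodMap f.injective).injOn _

lemma disjoint_pairsAt_image {Q : Planting V k} {f : Fin k ↪ V} {y : V} (hy : y ∉ Set.range f)
    (E : Set (Fin k × Fin k)) :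
    Disjoint (Q.pairsAt y) (Prod.map f f '' E) := by
  rw [Set.disjoint_left]
  rintro _ hpair ⟨⟨i, j⟩, -, rfl⟩
  simp only [pairsAt, Finset.mem_product, Finset.mem_singleton, Set.mem_ofPred_eq,
    Prod.map_fst, Prod.map_snd] at hpair
  grind

end Chain

section Candidates

variable {V : Type*} [Fintype V] [DecidableEq V] {k : ℕ} (Q : Planting V k)

/-- A sequence of looped nodes, lying in the planted tournament exactly at the positions in `P`,
that may enumerate a second tournament of `k` nodes in a digraph with the planted structure. -/
structure Candidate (P : Finset (Fin k)) (f : Fin k ↪ V) : Prop where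
  notMem_U : ∀ i, f i ∉ Q.U
  mem_T_iff : ∀ i, f i ∈ Q.T ↔ i ∈ P
  mem_rest : P.Nonempty → ∀ i ∉ P, f i ∈ Q.rest
  le_iff : ∀ {i j a b}, Q.node a = f i → Q.node b = f j → (a ≤ b ↔ i ≤ j)

variable {Q} {P : Finset (Fin k)} {f : Fin k ↪ V}

lemma Candidate.disjoint_fixedPairs (hf : Q.Candidate P f) :
    Disjoint (Q.fixedPairs : Set (V × V)) (Prod.map f f '' freshPairs P) := by
  rw [Set.disjoint_left]
  rintro _ hfixed ⟨⟨i, j⟩, hij, rfl⟩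
  obtain ⟨hne, hnotP⟩ := mem_freshPairs.1 hij
  simp only [fixedPairs, Finset.coe_filter, Finset.mem_univ, true_and, Set.mem_ofPred_eq,
    Finset.mem_product, Prod.map_fst, Prod.map_snd, hf.mem_T_iff] at hfixed
  rcases hfixed with heq | hTT | ⟨hi, hj⟩ | ⟨hi, hj⟩
  · exact hne (f.injective heq)
  · exact hnotP hTT
  · exact (Q.mem_rest.1 (hf.mem_rest ⟨j, hj⟩ i fun h => hnotP ⟨h, hj⟩)).2 hi
  · exact (Q.mem_rest.1 (hf.mem_rest ⟨i, hi⟩ j fun h => hnotP ⟨hi, h⟩)).2 hj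

lemma half_le_fairBits_real_iInter_loose (hk : (k : ℝ) * (2 * (3 / 4) ^ k) ≤ 1 / 2)
    {X : Finset V} (hX : X ⊆ Q.rest) (hXk : X.card ≤ k) :
    1 / 2 ≤ (fairBits (V × V)).real (⋂ y ∈ X, Q.loose y) := by
  have hcompl : (fairBits (V × V)).real (⋂ y ∈ X, Q.loose y)ᶜ ≤ k * (2 * (3 / 4) ^ k) := by
    simp only [Set.compl_iInter]
    calc (fairBits (V × V)).real (⋃ y ∈ X, (Q.loose y)ᶜ)
        ≤ ∑ y ∈ X, (fairBits (V × V)).real (Q.loose y)ᶜ := measureReal_biUnion_finset_le _ _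
      _ ≤ X.card • (2 * (3 / 4) ^ k) := Finset.sum_le_card_nsmul X _ _ fun y hy =>
          Q.fairBits_real_loose_compl_le (Q.mem_rest.1 (hX hy)).1
      _ ≤ k * (2 * (3 / 4) ^ k) := by
          rw [nsmul_eq_mul]
          gcongr
  rw [probReal_compl_eq_one_sub (Set.toFinite _).measurableSet] at hcompl
  linarith

lemma fairBits_real_iInter_loose_sdiff_le (hk : (k : ℝ) * (2 * (3 / 4) ^ k) ≤ 1 / 2)
    {X : Finset V} (hXk : X.card ≤ k) :
    (fairBits (V × V)).real (⋂ y ∈ Q.rest \ X, Q.loose y) ≤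
      2 * (fairBits (V × V)).real (⋂ y ∈ Q.rest, Q.loose y) := by
  have hsplit : (fairBits (V × V)).real (⋂ y ∈ Q.rest, Q.loose y) =
      (fairBits (V × V)).real (⋂ y ∈ Q.rest \ X, Q.loose y) *
        (fairBits (V × V)).real (⋂ y ∈ Q.rest ∩ X, Q.loose y) := by
    rw [Q.fairBits_real_iInter_loose subset_rfl,
      Q.fairBits_real_iInter_loose Finset.sdiff_subset,
      Q.fairBits_real_iInter_loose Finset.inter_subset_left, mul_comm,
      Finset.prod_inter_mul_prod_sdiff]
  have hhalf := half_le_fairBits_real_iInter_loose (Q := Q) hk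
    (Finset.inter_subset_left (s₂ := X)) ((Finset.card_le_card Finset.inter_subset_right).trans hXk)
  have := mul_le_mul_of_nonneg_left hhalf
    (measureReal_nonneg (μ := fairBits (V × V)) (s := ⋂ y ∈ Q.rest \ X, Q.loose y))
  linarith

/-- The nodes of `f` are dropped from the requirement of being loose, which makes that requirement
independent of `chain P f` and changes its probability by a factor of at most `2`. -/
lemma Candidate.fairBits_real_planted_inter_chain_le (hf : Q.Candidate P f)
    (hk : (k : ℝ) * (2 * (3 / 4) ^ k) ≤ 1 / 2) :
    (fairBits (V × V)).real (Q.planted ∩ chain P f) ≤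
      2 * (fairBits (V × V)).real Q.planted * (1 / 2) ^ (freshPairs P).card := by
  set Y : Finset V := Q.rest \ Finset.univ.map f
  have hYsub : Y ⊆ Q.rest := Finset.sdiff_subset
  have hdisj : Disjoint ((Q.fixedPairs : Set (V × V)) ∪ ⋃ y ∈ Y, Q.pairsAt y)
      (Prod.map f f '' freshPairs P) := by
    refine Set.disjoint_union_left.2 ⟨hf.disjoint_fixedPairs,
      Set.disjoint_iUnion₂_left.2 fun y hy => disjoint_pairsAt_image ?_ _⟩
    simpa using (Finset.mem_sdiff.1 hy).2
  have hdep : DependsOn (· ∈ Q.fixed ∩ ⋂ y ∈ Y, Q.loose y)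
      ((Q.fixedPairs : Set (V × V)) ∪ ⋃ y ∈ Y, Q.pairsAt y) := fun ω ω' h =>
    congrArg₂ And (Q.dependsOn_fixed fun e he => h e (Or.inl he))
      (Q.dependsOn_iInter_loose Y fun e he => h e (Or.inr he))
  have hloose := fairBits_real_iInter_loose_sdiff_le (Q := Q) hk
    (X := Finset.univ.map f) (by simp)
  calc (fairBits (V × V)).real (Q.planted ∩ chain P f)
      ≤ (fairBits (V × V)).real ((Q.fixed ∩ ⋂ y ∈ Y, Q.loose y) ∩ chain P f) :=
        measureReal_mono (Set.inter_subset_inter_left _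
          (Set.inter_subset_inter_right _ (Set.biInter_subset_biInter_left hYsub)))
    _ = (fairBits (V × V)).real Q.fixed * (fairBits (V × V)).real (⋂ y ∈ Y, Q.loose y) *
          (1 / 2) ^ (freshPairs P).card := by
        rw [fairBits_real_inter hdep (dependsOn_chain P f) hdisj,
          Q.fairBits_real_fixed_inter hYsub, fairBits_real_chain]
    _ ≤ (fairBits (V × V)).real Q.fixed *
          (2 * (fairBits (V × V)).real (⋂ y ∈ Q.rest, Q.loose y)) *
          (1 / 2) ^ (freshPairs P).card := by gcongr
    _ = 2 * (fairBits (V × V)).real Q.planted * (1 / 2) ^ (freshPairs P).card := by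
        rw [planted, Q.fairBits_real_fixed_inter subset_rfl]
        ring

variable (Q) in
open Classical in
/-- The candidates that lie in the planted tournament exactly at the positions in `P`. -/
noncomputable def candidates (P : Finset (Fin k)) : Finset (Fin k ↪ V) := {f | Q.Candidate P f}

lemma mem_candidates : f ∈ Q.candidates P ↔ Q.Candidate P f := by simp [candidates]

variable (Q P f) in
/-- The positions in the planted tournament of the nodes that `f` takes at the positions in `P`. -/
def positions : Finset (Fin k) := {a | Q.node a ∈ P.map f}

lemma Candidate.exists_strictMono (hf : Q.Candidate P f) :
    ∃ g : P → Fin k, StrictMono g ∧ (∀ i : P, Q.node (g i) = f i) ∧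
      Set.range g = Q.positions P f := by
  choose g hg using fun i : P => Q.mem_T.1 ((hf.mem_T_iff i).2 i.2)
  refine ⟨g, strictMono_of_le_iff_le fun i j => (hf.le_iff (hg i) (hg j)).symm, hg, ?_⟩
  ext a
  simp only [positions, Set.mem_range, Finset.coe_filter, Finset.mem_univ, true_and,
    Finset.mem_map, Set.mem_ofPred_eq]
  refine ⟨fun ⟨i, hi⟩ => ⟨i, i.2, by rw [← hi, hg]⟩, fun ⟨i, hi, hia⟩ => ⟨⟨i, hi⟩, ?_⟩⟩
  exact Q.node.injective ((hg ⟨i, hi⟩).trans hia)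

lemma Candidate.card_positions (hf : Q.Candidate P f) : (Q.positions P f).card = P.card := by
  obtain ⟨g, hmono, -, hrange⟩ := hf.exists_strictMono
  rw [← Set.ncard_coe_finset, ← hrange, ← Set.image_univ,
    Set.ncard_image_of_injective _ hmono.injective, Set.ncard_univ, Nat.card_eq_fintype_card,
    Fintype.card_coe]

/-- A candidate lists its nodes in the planted tournament in increasing order. -/
lemma Candidate.eqOn_of_positions_eq {f' : Fin k ↪ V} (hf : Q.Candidate P f)
    (hf' : Q.Candidate P f') (h : Q.positions P f = Q.positions P f') : Set.EqOn f f' P := by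
  obtain ⟨g, hmono, hg, hrange⟩ := hf.exists_strictMono
  obtain ⟨g', hmono', hg', hrange'⟩ := hf'.exists_strictMono
  have hgg' : g = g' := (hmono.range_inj hmono').1 (by rw [hrange, hrange', h])
  intro i hi
  rw [← hg ⟨i, hi⟩, ← hg' ⟨i, hi⟩, hgg']

variable (Q) in
lemma card_candidates_le (P : Finset (Fin k)) :
    (Q.candidates P).card ≤ k.choose P.card * (Q.U ∪ Q.T)ᶜ.card ^ (k - P.card) := by
  let φ : (Fin k ↪ V) → Finset (Fin k) × ({i // i ∉ P} → V) :=
    fun f => (Q.positions P f, fun i => f i)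
  let R : Finset (Finset (Fin k) × ({i // i ∉ P} → V)) :=
    Finset.powersetCard P.card Finset.univ ×ˢ Fintype.piFinset fun _ => (Q.U ∪ Q.T)ᶜ
  have hR : R.card = k.choose P.card * (Q.U ∪ Q.T)ᶜ.card ^ (k - P.card) := by
    rw [Finset.card_product, Finset.card_powersetCard, Finset.card_univ, Fintype.card_fin,
      Fintype.card_piFinset, Finset.prod_const, Finset.card_univ, Fintype.card_subtype_compl,
      Fintype.card_fin, Fintype.card_coe]
  rw [← hR]
  refine Finset.card_le_card_of_injOn φ (fun f hf => ?_) fun f hf f' hf' h => ?_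
  · have hf := mem_candidates.1 hf
    have hmem : ∀ i : {i // i ∉ P}, f i ∈ (Q.U ∪ Q.T)ᶜ := fun i =>
      Finset.mem_compl.2 (Finset.notMem_union.2
        ⟨hf.notMem_U i, fun hT => i.2 ((hf.mem_T_iff i).1 hT)⟩)
    exact Finset.mem_product.2 ⟨Finset.mem_powersetCard_univ.2 hf.card_positions,
      Fintype.mem_piFinset.2 hmem⟩
  · obtain ⟨hpos, hrest⟩ := Prod.ext_iff.1 h
    ext i
    by_cases hi : i ∈ P
    · exact (mem_candidates.1 hf).eqOn_of_positions_eq (mem_candidates.1 hf') hpos hi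
    · exact congrFun hrest ⟨i, hi⟩

end Candidates

end Planting

section FirstMoment

lemma sq_le_two_pow_add (k : ℕ) : k ^ 2 ≤ 2 ^ (k + 5) := by
  induction k with
  | zero => norm_num
  | succ k ih =>
    have hk : k < 2 ^ k := Nat.lt_two_pow_self
    calc (k + 1) ^ 2 = k ^ 2 + (2 * k + 1) := by ring
      _ ≤ 2 ^ (k + 5) + 2 ^ (k + 5) := by
          refine add_le_add ih ?_
          rw [pow_add]
          omega
      _ = 2 ^ (k + 1 + 5) := by ring

lemma two_pow_mul_half_pow_add (a b : ℕ) : (2 : ℝ) ^ a * (1 / 2) ^ (a + b) = (1 / 2) ^ b := by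
  rw [pow_add, ← mul_assoc, ← mul_pow]
  norm_num

lemma sum_range_choose_mul_choose_le (k : ℕ) :
    ∑ m ∈ Finset.range k, ((k + 1).choose m : ℝ) *
      ((k + 1).choose m * (1 / 2) ^ ((k + 1 - m) * (m + 9))) ≤ 1 / 8 := by
  have hexp : ∀ m ∈ Finset.range k, 2 * (k + 1) + 14 ≤ (k + 1 - m) * (m + 9) := by
    intro m hm
    obtain ⟨r, rfl⟩ := Nat.exists_eq_add_of_lt (Finset.mem_range.1 hm)
    rw [show m + r + 1 + 1 - m = r + 2 by omega]
    nlinarith [Nat.zero_le (r * m)]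
  have hterm : ∀ m ∈ Finset.range k, ((k + 1).choose m : ℝ) *
      ((k + 1).choose m * (1 / 2) ^ ((k + 1 - m) * (m + 9))) ≤
      ((k + 1).choose m : ℝ) * (2 ^ (k + 1) * (1 / 2) ^ (2 * (k + 1) + 14)) := by
    intro m hm
    have hchoose : ((k + 1).choose m : ℝ) ≤ 2 ^ (k + 1) := by
      exact_mod_cast Nat.choose_le_two_pow _ _
    have hpow : (1 / 2 : ℝ) ^ ((k + 1 - m) * (m + 9)) ≤ (1 / 2) ^ (2 * (k + 1) + 14) :=
      pow_le_pow_of_le_one (by norm_num) (by norm_num) (hexp m hm)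
    gcongr
  have hsum : ∑ m ∈ Finset.range k, ((k + 1).choose m : ℝ) ≤ 2 ^ (k + 1) := by
    have htotal : ∑ m ∈ Finset.range (k + 1 + 1), ((k + 1).choose m : ℝ) = 2 ^ (k + 1) := by
      exact_mod_cast Nat.sum_range_choose (k + 1)
    rw [← htotal]
    exact Finset.sum_le_sum_of_subset_of_nonneg (Finset.range_mono (by omega))
      fun _ _ _ => by positivity
  calc _ ≤ ∑ m ∈ Finset.range k,
        ((k + 1).choose m : ℝ) * (2 ^ (k + 1) * (1 / 2) ^ (2 * (k + 1) + 14)) :=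
        Finset.sum_le_sum hterm
    _ ≤ 2 ^ (k + 1) * (2 ^ (k + 1) * (1 / 2) ^ (2 * (k + 1) + 14)) := by
        rw [← Finset.sum_mul]
        gcongr
    _ = (1 / 2) ^ 14 := by rw [← mul_assoc, ← pow_add, ← two_mul, two_pow_mul_half_pow_add]
    _ ≤ 1 / 8 := by norm_num

lemma sum_choose_mul_choose_le (k : ℕ) :
    ∑ m ∈ Finset.range k, (k.choose m : ℝ) * (k.choose m * (1 / 2) ^ ((k - m) * (m + 9))) ≤
      1 / 4 := by
  rcases k with _ | k
  · norm_num
  have hsq : ((k + 1 : ℕ) : ℝ) ^ 2 ≤ 2 ^ (k + 1 + 5) := by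
    exact_mod_cast sq_le_two_pow_add (k + 1)
  have hlast : ((k + 1).choose k : ℝ) *
      ((k + 1).choose k * (1 / 2) ^ ((k + 1 - k) * (k + 9))) ≤ 1 / 8 := by
    rw [Nat.choose_succ_self_right, Nat.add_sub_cancel_left, one_mul, ← mul_assoc, ← pow_two]
    calc ((k + 1 : ℕ) : ℝ) ^ 2 * (1 / 2) ^ (k + 9)
        ≤ 2 ^ (k + 1 + 5) * (1 / 2) ^ (k + 9) := by gcongr
      _ = (1 / 2) ^ 3 := two_pow_mul_half_pow_add (k + 6) 3
      _ = 1 / 8 := by norm_num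
  rw [Finset.sum_range_succ]
  linarith [sum_range_choose_mul_choose_le k]

lemma pow_mul_half_pow_le {n k m r c : ℕ} (hn : 1024 * n ≤ 2 ^ k) (hk : m + r = k)
    (hc : c + r = r * (2 * m + r)) :
    (n : ℝ) ^ r * (1 / 2) ^ c ≤ (1 / 2) ^ (r * (m + 9)) := by
  have hbase : (n : ℝ) ≤ 2 ^ k * (1 / 2) ^ 10 := by
    have : (1024 : ℝ) * n ≤ 2 ^ k := by exact_mod_cast hn
    linarith
  have hexp : 10 * r + c = k * r + r * (m + 9) := by
    subst hk
    nlinarith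
  calc (n : ℝ) ^ r * (1 / 2) ^ c ≤ (2 ^ k * (1 / 2) ^ 10) ^ r * (1 / 2) ^ c := by gcongr
    _ = 2 ^ (k * r) * (1 / 2) ^ (10 * r + c) := by
        rw [mul_pow, ← pow_mul, ← pow_mul, mul_assoc, ← pow_add]
    _ = (1 / 2) ^ (r * (m + 9)) := by rw [hexp, two_pow_mul_half_pow_add]

lemma sum_ssubsets_choose_mul_le (k : ℕ) :
    ∑ P ∈ (Finset.univ : Finset (Fin k)).ssubsets,
      ((k.choose P.card : ℝ) * (1 / 2) ^ ((k - P.card) * (P.card + 9))) ≤ 1 / 4 := by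
  refine le_trans ?_ (sum_choose_mul_choose_le k)
  have h := Finset.sum_powerset_apply_card
    (fun m => (k.choose m : ℝ) * (1 / 2) ^ ((k - m) * (m + 9)))
    (x := (Finset.univ : Finset (Fin k)))
  rw [Finset.card_univ, Fintype.card_fin, Finset.sum_range_succ] at h
  rw [← Finset.sum_erase_add _ _ (Finset.mem_powerset_self _), ← Finset.ssubsets] at h
  simp only [nsmul_eq_mul, Finset.card_univ, Fintype.card_fin, Nat.choose_self] at h
  norm_num at h ⊢
  linarith

namespace Planting

variable {V : Type*} [Fintype V] [DecidableEq V] {k : ℕ} (Q : Planting V k)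

lemma fairBits_real_iUnion_candidates_le (hn : 1024 * (Q.U ∪ Q.T)ᶜ.card ≤ 2 ^ k)
    (hk : (k : ℝ) * (2 * (3 / 4) ^ k) ≤ 1 / 2) (P : Finset (Fin k)) :
    (fairBits (V × V)).real (⋃ f ∈ Q.candidates P, Q.planted ∩ chain P f) ≤
      2 * (fairBits (V × V)).real Q.planted *
        (k.choose P.card * (1 / 2) ^ ((k - P.card) * (P.card + 9))) := by
  have hPk : P.card + (k - P.card) = k := by
    have : P.card ≤ k := by simpa using Finset.card_le_univ P
    omega
  set n := (Q.U ∪ Q.T)ᶜ.card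
  have hcard : ((Q.candidates P).card : ℝ) ≤ k.choose P.card * (n : ℝ) ^ (k - P.card) := by
    exact_mod_cast Q.card_candidates_le P
  calc (fairBits (V × V)).real (⋃ f ∈ Q.candidates P, Q.planted ∩ chain P f)
      ≤ ∑ f ∈ Q.candidates P, (fairBits (V × V)).real (Q.planted ∩ chain P f) :=
        measureReal_biUnion_finset_le _ _
    _ ≤ (Q.candidates P).card •
          (2 * (fairBits (V × V)).real Q.planted * (1 / 2) ^ (freshPairs P).card) :=
        Finset.sum_le_card_nsmul _ _ _ fun f hf =>
          (mem_candidates.1 hf).fairBits_real_planted_inter_chain_le hk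
    _ ≤ (k.choose P.card * (n : ℝ) ^ (k - P.card)) *
          (2 * (fairBits (V × V)).real Q.planted * (1 / 2) ^ (freshPairs P).card) := by
        rw [nsmul_eq_mul]
        gcongr
    _ = 2 * (fairBits (V × V)).real Q.planted *
          (k.choose P.card * ((n : ℝ) ^ (k - P.card) * (1 / 2) ^ (freshPairs P).card)) := by ring
    _ ≤ _ := by
        gcongr
        exact pow_mul_half_pow_le hn hPk (card_freshPairs hPk)

lemma fairBits_real_iUnion_ssubsets_le (hn : 1024 * (Q.U ∪ Q.T)ᶜ.card ≤ 2 ^ k)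
    (hk : (k : ℝ) * (2 * (3 / 4) ^ k) ≤ 1 / 2) :
    (fairBits (V × V)).real (⋃ P ∈ (Finset.univ : Finset (Fin k)).ssubsets,
      ⋃ f ∈ Q.candidates P, Q.planted ∩ chain P f) ≤ (fairBits (V × V)).real Q.planted / 2 := by
  refine (measureReal_biUnion_finset_le _ _).trans ((Finset.sum_le_sum fun P _ =>
    Q.fairBits_real_iUnion_candidates_le hn hk P).trans ?_)
  rw [← Finset.mul_sum]
  have := mul_le_mul_of_nonneg_left (sum_ssubsets_choose_mul_le k)
    (measureReal_nonneg (μ := fairBits (V × V)) (s := Q.planted))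
  linarith

end Planting

end FirstMoment

namespace Planting

section Realization

variable {V : Type*} [Fintype V] [DecidableEq V] {k : ℕ} (Q : Planting V k)

/-- The digraphs in which the planted tournament is the only one with `k` nodes and the attached
node classes are the planted ones. -/
def realized : Set (V × V → Bool) :=
  {ω | unlooped (ofBits ω) = Q.U ∧
    {S | IsTournament (ofBits ω) S ∧ S.ncard = k} = {(Q.T : Set V)} ∧
    unloopedZero (ofBits ω) Q.T = Q.A ∧ unloopedConn (ofBits ω) Q.T = Q.A ∧
    loopedConn (ofBits ω) Q.T = Q.B}

variable {Q} {ω : V × V → Bool}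

lemma looped_ofBits_iff (hω : ω ∈ Q.fixed) {x : V} : Looped (ofBits ω) x ↔ x ∉ Q.U := by
  have hbit : ω (x, x) = true ↔ x ∉ Q.U := by
    rw [hω (x, x) (by simp [fixedPairs])]
    have hnode : ∀ i j, Q.node i = x → Q.node j = x → i ≤ j := fun i j hi hj =>
      (Q.node.injective (hi.trans hj.symm)).le
    simpa [fixedBit] using fun _ => hnode
  exact hbit

lemma adj_node_iff (hω : ω ∈ Q.fixed) (i j : Fin k) :
    (ofBits ω).Adj (Q.node i) (Q.node j) ↔ i ≤ j := by
  have hbit : ω (Q.node i, Q.node j) = true ↔ i ≤ j := by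
    rw [hω (Q.node i, Q.node j) (by simp [fixedPairs, node_mem_T])]
    simp [fixedBit, Q.node_notMem_U]
  exact hbit

lemma double_of_mem_D (hω : ω ∈ Q.fixed) {d t : V} (hd : d ∈ Q.D) (ht : t ∈ Q.T) :
    Double (ofBits ω) d t := by
  have hdT : ∀ i, Q.node i ≠ d := fun i h => Q.notMem_D_of_mem_T (h ▸ Q.node_mem_T i) hd
  have hne : d ≠ t := fun h => Q.notMem_D_of_mem_T ht (h ▸ hd)
  have hout : ω (d, t) = true := by
    rw [hω (d, t) (by simp [fixedPairs, hd, ht])]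
    simp [fixedBit, hne, hdT]
  have hin : ω (t, d) = true := by
    rw [hω (t, d) (by simp [fixedPairs, hd, ht])]
    simp [fixedBit, hne.symm, hdT]
  exact ⟨hout, hin⟩

lemma exists_not_connected_of_mem_rest (hω : ω ∈ Q.planted) {y : V} (hy : y ∈ Q.rest) :
    ∃ t ∈ Q.T, ¬ Connected (ofBits ω) y t := by
  obtain ⟨t, ht, hbits⟩ := Set.mem_iUnion₂.1 (Set.mem_iInter₂.1 hω.2 y hy).1
  exact ⟨t, ht, not_connected_ofBits_iff.2 hbits⟩

lemma exists_single_of_mem_rest (hω : ω ∈ Q.planted) {y : V} (hy : y ∈ Q.rest) :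
    ∃ t ∈ Q.T, (ofBits ω).Adj y t ∧ ¬ (ofBits ω).Adj t y := by
  obtain ⟨t, ht, hbits⟩ := Set.mem_iUnion₂.1 (Set.mem_iInter₂.1 hω.2 y hy).2
  exact ⟨t, ht, single_ofBits_iff.2 hbits⟩

lemma mem_rest_of_mem_U {x : V} (hU : x ∈ Q.U) (hA : x ∉ Q.A) : x ∈ Q.rest :=
  Q.mem_rest.2 ⟨fun hT => Q.notMem_U_of_mem_T hT hU, Q.notMem_D_of_mem_U hU hA⟩

lemma unlooped_ofBits (hω : ω ∈ Q.fixed) : unlooped (ofBits ω) = Q.U := by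
  ext x
  change ¬ Looped (ofBits ω) x ↔ x ∈ Q.U
  rw [looped_ofBits_iff hω, not_not]

lemma isTournament_T (hω : ω ∈ Q.fixed) : IsTournament (ofBits ω) (Q.T : Set V) := by
  rw [coe_T]
  exact isTournament_range (adj_node_iff hω)

lemma unloopedZero_ofBits (hω : ω ∈ Q.planted) : unloopedZero (ofBits ω) Q.T = Q.A := by
  ext x
  constructor
  · rintro ⟨hloop, hzero⟩
    rw [looped_ofBits_iff hω.1, not_not] at hloop
    by_contra hA
    obtain ⟨t, ht, hsingle⟩ := exists_single_of_mem_rest hω (mem_rest_of_mem_U hloop hA)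
    exact hzero t ht hsingle
  · intro hA
    exact ⟨fun hloop => (looped_ofBits_iff hω.1).1 hloop (Q.A_subset hA), fun t ht hsingle =>
      hsingle.2 (double_of_mem_D hω.1 (Finset.mem_union_left _ hA) ht).2⟩

lemma unloopedConn_ofBits (hω : ω ∈ Q.planted) : unloopedConn (ofBits ω) Q.T = Q.A := by
  ext x
  constructor
  · rintro ⟨hloop, hconn⟩
    rw [looped_ofBits_iff hω.1, not_not] at hloop
    by_contra hA
    obtain ⟨t, ht, hnot⟩ := exists_not_connected_of_mem_rest hω (mem_rest_of_mem_U hloop hA)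
    exact hnot (hconn t ht)
  · intro hA
    exact ⟨fun hloop => (looped_ofBits_iff hω.1).1 hloop (Q.A_subset hA), fun t ht =>
      Or.inl (double_of_mem_D hω.1 (Finset.mem_union_left _ hA) ht).1⟩

lemma loopedConn_ofBits (hω : ω ∈ Q.planted) : loopedConn (ofBits ω) Q.T = Q.B := by
  ext x
  constructor
  · rintro ⟨hloop, hT, hconn⟩
    rw [looped_ofBits_iff hω.1] at hloop
    by_contra hB
    obtain ⟨t, ht, hnot⟩ := exists_not_connected_of_mem_rest hω
      (Q.mem_rest.2 ⟨hT, Q.notMem_D_of_notMem_U hloop hB⟩)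
    exact hnot (hconn t ht)
  · intro hB
    have hD : x ∈ Q.D := Finset.mem_union_right _ hB
    exact ⟨(looped_ofBits_iff hω.1).2 (Finset.disjoint_left.1 Q.B_disjoint hB),
      fun hT => Q.notMem_D_of_mem_T hT hD, fun t ht => Or.inl (double_of_mem_D hω.1 hD ht).1⟩

lemma exists_candidate (hω : ω ∈ Q.planted) {S : Set V} (hS : IsTournament (ofBits ω) S)
    (hSk : S.ncard = k) (hST : S ≠ Q.T) :
    ∃ P ⊂ Finset.univ, ∃ f, Q.Candidate P f ∧ ω ∈ chain P f := by
  subst hSk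
  obtain ⟨f, hrange, hf⟩ := hS.exists_enum
  let P : Finset (Fin S.ncard) := Finset.univ.filter fun i => f i ∈ Q.T
  have hP : ∀ i, f i ∈ Q.T ↔ i ∈ P := fun i => by simp [P]
  have hproper : P ⊂ Finset.univ := by
    refine Finset.ssubset_univ_iff.2 fun hPu => hST (Set.eq_of_subset_of_ncard_le ?_ ?_)
    · intro x hx
      obtain ⟨i, rfl⟩ := hrange.ge hx
      exact (hP i).2 (hPu ▸ Finset.mem_univ i)
    · rw [Set.ncard_coe_finset, Q.card_T]
  have hrest : P.Nonempty → ∀ i ∉ P, f i ∈ Q.rest := by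
    rintro ⟨j, hj⟩ i hi
    refine Q.mem_rest.2 ⟨fun hT => hi ((hP i).1 hT), fun hD => hi ?_⟩
    obtain ⟨hij, hji⟩ := double_of_mem_D hω.1 hD ((hP j).2 hj)
    rwa [le_antisymm ((hf i j).1 hij) ((hf j i).1 hji)]
  refine ⟨P, hproper, f, ⟨fun i => ?_, hP, hrest, fun ha hb => ?_⟩, fun e _ => ?_⟩
  · exact (looped_ofBits_iff hω.1).1 ((hf i i).2 le_rfl)
  · rw [← adj_node_iff hω.1, ha, hb, hf]
  · exact Bool.eq_iff_iff.2 ((hf e.1 e.2).trans decide_eq_true_iff.symm)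

lemma planted_sdiff_realized_subset :
    Q.planted \ Q.realized ⊆ ⋃ P ∈ (Finset.univ : Finset (Fin k)).ssubsets,
      ⋃ f ∈ Q.candidates P, Q.planted ∩ chain P f := by
  rintro ω ⟨hω, hnot⟩
  obtain ⟨S, hS, hSk, hST⟩ : ∃ S, IsTournament (ofBits ω) S ∧ S.ncard = k ∧ S ≠ Q.T := by
    by_contra! hunique
    have hT : {S | IsTournament (ofBits ω) S ∧ S.ncard = k} = {(Q.T : Set V)} :=
      Set.eq_singleton_iff_unique_mem.2
        ⟨⟨isTournament_T hω.1, by rw [Set.ncard_coe_finset, Q.card_T]⟩,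
          fun S hS => hunique S hS.1 hS.2⟩
    exact hnot ⟨unlooped_ofBits hω.1, hT, unloopedZero_ofBits hω, unloopedConn_ofBits hω,
      loopedConn_ofBits hω⟩
  obtain ⟨P, hP, f, hf, hchain⟩ := exists_candidate hω hS hSk hST
  simp only [Set.mem_iUnion]
  exact ⟨P, Finset.mem_ssubsets.2 hP, f, mem_candidates.2 hf, hω, hchain⟩

lemma le_fairBits_real_realized (hn : 1024 * (Q.U ∪ Q.T)ᶜ.card ≤ 2 ^ k)
    (hk : (k : ℝ) * (2 * (3 / 4) ^ k) ≤ 1 / 2) :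
    (fairBits (V × V)).real Q.planted / 2 ≤ (fairBits (V × V)).real Q.realized := by
  have hsdiff : (fairBits (V × V)).real (Q.planted \ Q.realized) ≤
      (fairBits (V × V)).real Q.planted / 2 :=
    (measureReal_mono planted_sdiff_realized_subset (measure_ne_top _ _)).trans
      (Q.fairBits_real_iUnion_ssubsets_le hn hk)
  have hsplit : (fairBits (V × V)).real Q.planted - (fairBits (V × V)).real Q.realized ≤
      (fairBits (V × V)).real (Q.planted \ Q.realized) := le_measureReal_sdiff
  linarith

end Realization

end Planting

section Estimates

lemma exp_neg_two_mul_le_one_sub {x : ℝ} (h0 : 0 ≤ x) (h1 : x ≤ 1 / 2) :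
    Real.exp (-(2 * x)) ≤ 1 - x := by
  have hpos : 0 < 1 - x := by linarith
  rw [← Real.le_log_iff_exp_le hpos]
  refine le_trans ?_ (Real.one_sub_inv_le_log_of_pos hpos)
  have hinv : (1 - x)⁻¹ ≤ 1 + 2 * x := by
    rw [inv_le_iff_one_le_mul₀ hpos]
    nlinarith
  linarith

lemma two_pow_le_exp (m : ℕ) : (2 : ℝ) ^ m ≤ Real.exp m := by
  rw [← Real.exp_one_pow]
  gcongr
  exact Real.exp_one_gt_two.le

lemma exp_neg_le_half_pow (m : ℕ) : Real.exp (-(m : ℝ)) ≤ (1 / 2 : ℝ) ^ m := by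
  rw [Real.exp_neg, one_div, inv_pow]
  exact inv_anti₀ (by positivity) (two_pow_le_exp m)

variable {k n N d : ℕ}

lemma exp_neg_le_one_sub_pow (hk : 5 ≤ k) (hn : 1024 * n ≤ 2 ^ k) (hN : N ≤ 3 * n) :
    Real.exp (-(3 / 2) ^ k) ≤ (1 - 2 * (3 / 4 : ℝ) ^ k) ^ N := by
  have hsmall : (3 / 4 : ℝ) ^ k ≤ 1 / 4 :=
    (pow_le_pow_of_le_one (by norm_num) (by norm_num) hk).trans (by norm_num)
  have hN' : 4 * (N : ℝ) ≤ 2 ^ k := by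
    have : 4 * N ≤ 2 ^ k := by omega
    exact_mod_cast this
  have hexp : (N : ℝ) * (2 * (2 * (3 / 4) ^ k)) ≤ (3 / 2) ^ k := by
    calc (N : ℝ) * (2 * (2 * (3 / 4) ^ k)) = 4 * N * (3 / 4) ^ k := by ring
      _ ≤ 2 ^ k * (3 / 4) ^ k := by gcongr
      _ = (3 / 2) ^ k := by rw [← mul_pow]; norm_num
  calc Real.exp (-(3 / 2) ^ k) ≤ Real.exp (N * -(2 * (2 * (3 / 4) ^ k))) :=
        Real.exp_le_exp.2 (by linarith)
    _ = Real.exp (-(2 * (2 * (3 / 4) ^ k))) ^ N := Real.exp_nat_mul _ _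
    _ ≤ (1 - 2 * (3 / 4 : ℝ) ^ k) ^ N := by
        gcongr
        exact exp_neg_two_mul_le_one_sub (by positivity) (by linarith)

lemma exp_neg_le_half_pow_mul_one_sub_pow (hk : 5 ≤ k) (hn : 1024 * n ≤ 2 ^ k) (hN : N ≤ 3 * n)
    (hd : (d : ℝ) ≤ (3 / 2) ^ k) :
    Real.exp (-((k : ℝ) ^ 2 + (2 * k + 1) * (3 / 2) ^ k + 1)) ≤
      (1 / 2) ^ (k ^ 2 + 2 * k * d) * (1 - 2 * (3 / 4) ^ k) ^ N / 2 := by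
  have hbits : Real.exp (-((k : ℝ) ^ 2 + 2 * k * (3 / 2) ^ k)) ≤
      (1 / 2 : ℝ) ^ (k ^ 2 + 2 * k * d) := by
    refine le_trans (Real.exp_le_exp.2 (neg_le_neg ?_)) (exp_neg_le_half_pow _)
    push_cast
    gcongr
  have hhalf : Real.exp (-1) ≤ 1 / 2 := by simpa using exp_neg_le_half_pow 1
  calc Real.exp (-((k : ℝ) ^ 2 + (2 * k + 1) * (3 / 2) ^ k + 1))
      = Real.exp (-((k : ℝ) ^ 2 + 2 * k * (3 / 2) ^ k)) * Real.exp (-(3 / 2) ^ k) *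
          Real.exp (-1) := by
        rw [← Real.exp_add, ← Real.exp_add]
        ring_nf
    _ ≤ (1 / 2 : ℝ) ^ (k ^ 2 + 2 * k * d) * (1 - 2 * (3 / 4) ^ k) ^ N * (1 / 2) := by
        have hN := exp_neg_le_one_sub_pow hk hn hN
        have := (Real.exp_pos _).le.trans hN
        gcongr
    _ = _ := by ring

lemma four_pow_mul_pow_le_exp_neg (hk : 10000 ≤ k) (hN : N ≤ 3 * n) :
    (4 : ℝ) ^ N * (3 / 4) ^ (k * n / 200) ≤ Real.exp (-n) := by
  have hexp : 50 * n ≤ k * n / 200 := by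
    rw [Nat.le_div_iff_mul_le (by norm_num)]
    nlinarith
  have hfour : (4 : ℝ) ^ N ≤ 4 ^ (3 * n) := pow_le_pow_right₀ (by norm_num) hN
  have hquarters : (3 / 4 : ℝ) ^ (k * n / 200) ≤ (3 / 4) ^ (50 * n) :=
    pow_le_pow_of_le_one (by norm_num) (by norm_num) hexp
  have hbase : (4 : ℝ) ^ 3 * (3 / 4) ^ 50 ≤ Real.exp (-1) :=
    le_trans (by norm_num) Real.exp_neg_one_gt_d9.le
  calc (4 : ℝ) ^ N * (3 / 4) ^ (k * n / 200) ≤ 4 ^ (3 * n) * (3 / 4) ^ (50 * n) := by gcongr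
    _ = (4 ^ 3 * (3 / 4) ^ 50) ^ n := by rw [mul_pow, ← pow_mul, ← pow_mul]
    _ ≤ Real.exp (-1) ^ n := by gcongr
    _ = Real.exp (-n) := by rw [← Real.exp_nat_mul, mul_neg_one]

lemma mul_exp_neg_add_le (hk : 10000 ≤ k) (hn : 1024 * n ≤ 2 ^ k) (hn0 : n ≠ 0)
    (hN : N ≤ 3 * n) :
    N * (2 * Real.exp (-n / (128 * k ^ 2))) + 2 * (4 ^ N * (3 / 4) ^ (k * n / 200)) ≤
      Real.exp (k - n / (128 * k ^ 2)) := by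
  have hN' : (2 * N + 2 : ℝ) ≤ 2 ^ k := by
    have : 2 * N + 2 ≤ 2 ^ k := by omega
    exact_mod_cast this
  have hk' : (1 : ℝ) ≤ 128 * k ^ 2 := by
    have : (1 : ℝ) ≤ k := by exact_mod_cast (by omega : 1 ≤ k)
    nlinarith
  have hdiv : Real.exp (-n) ≤ Real.exp (-n / (128 * k ^ 2)) := by
    rw [Real.exp_le_exp, neg_div, neg_le_neg_iff]
    exact div_le_self (by positivity) hk'
  calc _ ≤ (2 * N + 2) * Real.exp (-n / (128 * k ^ 2)) := by
        linarith [four_pow_mul_pow_le_exp_neg hk hN]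
    _ ≤ Real.exp k * Real.exp (-n / (128 * k ^ 2)) := by
        gcongr
        exact hN'.trans (two_pow_le_exp k)
    _ = Real.exp (k - n / (128 * k ^ 2)) := by rw [← Real.exp_add, neg_div, ← sub_eq_add_neg]

lemma error_le (hk : 10000 ≤ k) (hn : 1024 * n ≤ 2 ^ k)
    (hkn : (2 : ℝ) ^ 14 * (3 / 2) ^ k * k ^ 4 ≤ n) (hN : N ≤ 3 * n)
    (hd : (d : ℝ) ≤ (3 / 2) ^ k) :
    N * (2 * Real.exp (-n / (128 * k ^ 2))) + 2 * (4 ^ N * (3 / 4) ^ (k * n / 200)) ≤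
      Real.exp (-k) * ((1 / 2) ^ (k ^ 2 + 2 * k * d) * (1 - 2 * (3 / 4) ^ k) ^ N / 2) := by
  have hk1 : (1 : ℝ) ≤ k := by exact_mod_cast (by omega : 1 ≤ k)
  have hs : (1 : ℝ) ≤ (3 / 2) ^ k := one_le_pow₀ (by norm_num)
  have hn0 : n ≠ 0 := by
    rintro rfl
    have : (0 : ℝ) < 2 ^ 14 * (3 / 2) ^ k * k ^ 4 := by positivity
    exact absurd hkn (by simpa using this)
  set s : ℝ := (3 / 2) ^ k
  have hX : 128 * (s * k ^ 2) ≤ n / (128 * k ^ 2) := by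
    rw [le_div_iff₀ (by positivity)]
    linarith
  have hexp : (k : ℝ) + (k ^ 2 + (2 * k + 1) * s + 1) + k ≤ 128 * (s * k ^ 2) := by
    have hkk : (k : ℝ) ≤ k ^ 2 := le_self_pow₀ hk1 two_ne_zero
    have hsk : (k : ℝ) ^ 2 ≤ s * k ^ 2 := le_mul_of_one_le_left (by positivity) hs
    have hks : s * k ≤ s * k ^ 2 := by gcongr
    have hs1 : s ≤ s * k := le_mul_of_one_le_right (by positivity) hk1
    linarith
  calc _ ≤ Real.exp (k - n / (128 * k ^ 2)) := mul_exp_neg_add_le hk hn hn0 hN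
    _ ≤ Real.exp (-k + -((k : ℝ) ^ 2 + (2 * k + 1) * s + 1)) :=
        Real.exp_le_exp.2 (by linarith)
    _ ≤ _ := by
        rw [Real.exp_add]
        gcongr
        exact exp_neg_le_half_pow_mul_one_sub_pow (by omega) hn hN hd

end Estimates

section Parameters

/-- The size of `k` from which on all estimates hold. -/
structure LargeK (k : ℕ) : Prop where
  le : 10000 ≤ k
  pow_le : (2 : ℝ) ^ 26 * k ^ 4 ≤ (4 / 3) ^ k

lemma LargeK.one_le {k : ℕ} (hk : LargeK k) : (1 : ℝ) ≤ k := by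
  exact_mod_cast (show 1 ≤ 10000 by norm_num).trans hk.le

lemma LargeK.mul_pow_le {k : ℕ} (hk : LargeK k) : (k : ℝ) * (2 * (3 / 4) ^ k) ≤ 1 / 2 := by
  have hk4 : (k : ℝ) ≤ k ^ 4 := le_self_pow₀ hk.one_le four_ne_zero
  have hinv : (3 / 4 : ℝ) ^ k * (4 / 3) ^ k = 1 := by
    rw [← mul_pow]
    norm_num
  calc (k : ℝ) * (2 * (3 / 4) ^ k) ≤ (1 / 4 * (4 / 3) ^ k) * (2 * (3 / 4) ^ k) := by
        gcongr
        linarith [hk.pow_le]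
    _ = 1 / 2 := by linear_combination 1 / 2 * hinv

lemma LargeK.two_mul_pow_le {k : ℕ} (hk : LargeK k) : 2 * (3 / 4 : ℝ) ^ k ≤ 1 / 2 :=
  (le_mul_of_one_le_left (by positivity) hk.one_le).trans hk.mul_pow_le

lemma eventually_largeK : ∀ᶠ k : ℕ in atTop, LargeK k := by
  have hlim := tendsto_pow_const_div_const_pow_of_one_lt 4 (show (1 : ℝ) < 4 / 3 by norm_num)
  filter_upwards [hlim.eventually (gt_mem_nhds (show (0 : ℝ) < 1 / 2 ^ 26 by norm_num)),
    eventually_ge_atTop 10000] with k hsmall hk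
  rw [div_lt_div_iff₀ (by positivity) (by positivity)] at hsmall
  exact ⟨hk, by linarith⟩

lemma tendsto_kOf : Tendsto kOf atTop atTop := by
  have hsq : Tendsto (fun p : ℕ => 4 * (p : ℝ) ^ 2) atTop atTop :=
    ((tendsto_pow_atTop two_ne_zero).comp tendsto_natCast_atTop_atTop).const_mul_atTop (by norm_num)
  exact tendsto_nat_ceil_atTop.comp ((Real.tendsto_logb_atTop (by norm_num)).comp hsq)

lemma four_mul_sq_le (p : ℕ) : 4 * (p : ℝ) ^ 2 ≤ (3 / 2) ^ kOf p := by
  rcases Nat.eq_zero_or_pos p with rfl | hp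
  · norm_num
  · have h := Nat.le_ceil (Real.logb (3 / 2) (4 * (p : ℝ) ^ 2))
    rwa [Real.logb_le_iff_le_rpow (by norm_num) (by positivity), Real.rpow_natCast] at h

lemma nOf_mul_le (p : ℕ) : 1024 * nOf p ≤ 2 ^ kOf p := by
  have hfloor : (nOf p : ℝ) ≤ 2 ^ ((kOf p : ℝ) - 10) :=
    (Nat.floor_le (by positivity)).trans
      (Real.rpow_le_rpow_of_exponent_le (by norm_num) (by linarith))
  rw [Real.rpow_sub two_pos, Real.rpow_natCast, le_div_iff₀ (by positivity)] at hfloor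
  norm_num at hfloor
  have : (1024 * nOf p : ℝ) ≤ 2 ^ kOf p := by linarith
  exact_mod_cast this

lemma two_pow_kOf_lt (p : ℕ) : 2 ^ kOf p < 2048 * (nOf p + 1) := by
  have hfloor : (2 : ℝ) ^ ((kOf p : ℝ) - 11) < nOf p + 1 :=
    (Real.rpow_le_rpow_of_exponent_le (by norm_num) (by linarith)).trans_lt
      (Nat.lt_floor_add_one _)
  rw [Real.rpow_sub two_pos, Real.rpow_natCast, div_lt_iff₀ (by positivity)] at hfloor
  norm_num at hfloor
  have : (2 : ℝ) ^ kOf p < 2048 * (nOf p + 1) := by linarith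
  exact_mod_cast this

variable {p : ℕ}

lemma LargeK.ne_zero (hp : LargeK (kOf p)) : p ≠ 0 := by
  rintro rfl
  simpa [kOf] using hp.le

lemma LargeK.pow_mul_pow_le_nOf (hp : LargeK (kOf p)) :
    (2 : ℝ) ^ 14 * (3 / 2) ^ kOf p * kOf p ^ 4 ≤ nOf p := by
  have hn : (2 : ℝ) ^ kOf p ≤ 4096 * nOf p := by
    have hlt := two_pow_kOf_lt p
    have h12 : 2 ^ 12 ≤ 2 ^ kOf p :=
      Nat.pow_le_pow_right two_pos (le_trans (by norm_num) hp.le)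
    have : 2 ^ kOf p ≤ 4096 * nOf p := by omega
    exact_mod_cast this
  have hsplit : (2 : ℝ) ^ kOf p = (3 / 2) ^ kOf p * (4 / 3) ^ kOf p := by
    rw [← mul_pow]
    norm_num
  have hmul := mul_le_mul_of_nonneg_left hp.pow_le (show (0 : ℝ) ≤ (3 / 2) ^ kOf p by positivity)
  linarith

lemma LargeK.kOf_le_nOf (hp : LargeK (kOf p)) : kOf p ≤ nOf p := by
  have hs : (1 : ℝ) ≤ 2 ^ 14 * (3 / 2) ^ kOf p :=
    one_le_mul_of_one_le_of_one_le (by norm_num) (one_le_pow₀ (by norm_num))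
  have hn : (kOf p : ℝ) ≤ nOf p :=
    calc (kOf p : ℝ) ≤ kOf p ^ 4 := le_self_pow₀ hp.one_le four_ne_zero
      _ ≤ 2 ^ 14 * (3 / 2) ^ kOf p * kOf p ^ 4 := le_mul_of_one_le_left (by positivity) hs
      _ ≤ (nOf p : ℝ) := hp.pow_mul_pow_le_nOf
  exact_mod_cast hn

lemma LargeK.two_mul_sq_le_nOf (hp : LargeK (kOf p)) : 2 * p ^ 2 ≤ nOf p := by
  have hn : 2 * (p : ℝ) ^ 2 ≤ nOf p :=
    calc 2 * (p : ℝ) ^ 2 ≤ 2 ^ 14 * (3 / 2 : ℝ) ^ kOf p := by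
          linarith [four_mul_sq_le p, sq_nonneg (p : ℝ)]
      _ ≤ 2 ^ 14 * (3 / 2) ^ kOf p * (kOf p : ℝ) ^ 4 :=
          le_mul_of_one_le_right (by positivity) (one_le_pow₀ hp.one_le)
      _ ≤ (nOf p : ℝ) := hp.pow_mul_pow_le_nOf
  exact_mod_cast hn

end Parameters

lemma Planting.exists_of_card {V : Type*} [Fintype V] [DecidableEq V] {k a b : ℕ}
    {U T : Finset V} (hT : T.card = k) (hUT : Disjoint U T) (ha : a ≤ U.card)
    (hb : b ≤ (U ∪ T)ᶜ.card) :
    ∃ Q : Planting V k, Q.U = U ∧ Q.T = T ∧ Q.A.card = a ∧ Q.B.card = b := by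
  obtain ⟨A, hAU, hA⟩ := Finset.exists_subset_card_eq ha
  obtain ⟨B, hBU, hB⟩ := Finset.exists_subset_card_eq hb
  have hBdisj : ∀ x ∈ B, x ∉ U ∧ x ∉ T := fun x hx => by simpa using hBU hx
  let e : Fin k ≃ T := (T.equivFinOfCardEq hT).symm
  let Q : Planting V k :=
    { node := e.toEmbedding.trans (Function.Embedding.subtype _)
      U := U
      A := A
      B := B
      A_subset := hAU
      B_disjoint := Finset.disjoint_left.2 fun x hx => (hBdisj x hx).1
      node_notMem_U := fun i => Finset.disjoint_right.1 hUT (e i).2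
      node_notMem_B := fun i hi => (hBdisj _ hi).2 (e i).2 }
  have hQT : Q.T ⊆ T := by
    intro x hx
    obtain ⟨i, rfl⟩ := Q.mem_T.1 hx
    exact (e i).2
  exact ⟨Q, rfl, Finset.eq_of_subset_of_card_le hQT (by rw [Q.card_T, hT]), hA, hB⟩

section Cells

variable {p : ℕ} {U T : Finset (Fin (numNodes p))}

/-- The digraphs in `𝒩_p` with un-looped nodes `U` and tournament `T`. -/
def cell (p : ℕ) (U T : Finset (Fin (numNodes p))) :
    Set (Fin (numNodes p) × Fin (numNodes p) → Bool) :=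
  {ω | ofBits ω ∈ classN p ∧ unlooped (ofBits ω) = U ∧
    {S | IsTournament (ofBits ω) S ∧ S.ncard = kOf p} = {(T : Set (Fin (numNodes p)))}}

lemma LargeK.card_compl_union (hp : LargeK (kOf p)) (hU : U.card = nOf p) (hT : T.card = kOf p)
    (hUT : Disjoint U T) : (U ∪ T)ᶜ.card + 1 = nOf p := by
  have hk := hp.le
  have hkn := hp.kOf_le_nOf
  rw [Finset.card_compl, Finset.card_union_of_disjoint hUT, hU, hT, Fintype.card_fin, numNodes]
  omega

lemma realized_subset_cell (Q : Planting (Fin (numNodes p)) (kOf p)) (hU : Q.U.card = nOf p)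
    (hA : Q.A.card = 2 * p ^ 2) (hB : Q.B.card + 1 = 2 * p ^ 2)
    (hL : (Q.U ∪ Q.T)ᶜ.card + 1 = nOf p) : Q.realized ⊆ cell p Q.U Q.T := by
  rintro ω ⟨hunlooped, hunique, hzero, hconn, hlooped⟩
  have hoff : loopedOff (ofBits ω) Q.T = ((Q.U ∪ Q.T)ᶜ : Finset (Fin (numNodes p))) := by
    ext x
    have hx : Looped (ofBits ω) x ↔ x ∉ Q.U := by
      rw [← Finset.mem_coe, ← hunlooped]
      exact not_not.symm
    simp [loopedOff, hx]
  refine ⟨⟨Q.T, hunique, ?_, ?_, ?_, ?_, ?_⟩, hunlooped, hunique⟩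
  · rw [hunlooped, Set.ncard_coe_finset, hU]
  · rw [hoff, Set.ncard_coe_finset, hL]
  · rw [hzero, Set.ncard_coe_finset, hA]
  · rw [hconn, Set.ncard_coe_finset, hA]
  · rw [hlooped, Set.ncard_coe_finset, hB]

lemma le_fairBits_real_cell (hp : LargeK (kOf p)) (hU : U.card = nOf p) (hT : T.card = kOf p)
    (hUT : Disjoint U T) :
    (1 / 2) ^ numNodes p * ((1 / 2) ^ (kOf p ^ 2 + 2 * kOf p * (4 * p ^ 2)) *
      (1 - 2 * (3 / 4) ^ kOf p) ^ numNodes p / 2) ≤ (fairBits _).real (cell p U T) := by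
  have hp1 : 1 ≤ p ^ 2 := Nat.one_le_pow _ _ (Nat.pos_of_ne_zero hp.ne_zero)
  have hL := hp.card_compl_union hU hT hUT
  have h2n := hp.two_mul_sq_le_nOf
  obtain ⟨Q, rfl, rfl, hA, hB⟩ := Planting.exists_of_card (a := 2 * p ^ 2) (b := 2 * p ^ 2 - 1)
    hT hUT (by omega) (by omega)
  have hD : Q.D.card ≤ 4 * p ^ 2 := (Finset.card_union_le _ _).trans (by omega)
  have hq := hp.two_mul_pow_le
  have hq0 : 0 ≤ 1 - 2 * (3 / 4 : ℝ) ^ kOf p := by linarith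
  calc (1 / 2 : ℝ) ^ numNodes p * ((1 / 2) ^ (kOf p ^ 2 + 2 * kOf p * (4 * p ^ 2)) *
        (1 - 2 * (3 / 4) ^ kOf p) ^ numNodes p / 2)
      = (1 / 2) ^ (numNodes p + kOf p ^ 2 + 2 * kOf p * (4 * p ^ 2)) *
          (1 - 2 * (3 / 4) ^ kOf p) ^ numNodes p / 2 := by ring
    _ ≤ (1 / 2) ^ (numNodes p + kOf p ^ 2 + 2 * kOf p * Q.D.card) *
          (1 - 2 * (3 / 4) ^ kOf p) ^ numNodes p / 2 := by
        gcongr ?_ * _ / _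
        exact pow_le_pow_of_le_one (by norm_num) (by norm_num) (by gcongr)
    _ ≤ (fairBits _).real Q.planted / 2 := by
        gcongr
        simpa using Q.le_fairBits_real_planted (by linarith)
    _ ≤ (fairBits _).real Q.realized :=
        Q.le_fairBits_real_realized (le_trans (by omega) (nOf_mul_le p)) hp.mul_pow_le
    _ ≤ (fairBits _).real (cell p Q.U Q.T) :=
        measureReal_mono (realized_subset_cell Q hU hA (by omega) hL)

lemma fairBits_real_cell_pos (hp : LargeK (kOf p)) (hU : U.card = nOf p) (hT : T.card = kOf p)
    (hUT : Disjoint U T) : 0 < (fairBits _).real (cell p U T) := by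
  have hq : 0 < 1 - 2 * (3 / 4 : ℝ) ^ kOf p := by linarith [hp.two_mul_pow_le]
  exact lt_of_lt_of_le (by positivity) (le_fairBits_real_cell hp hU hT hUT)

lemma fairBits_real_unlooped_inter_not_quasirandom {V : Type*} [Finite V] (U : Set V)
    (n k : ℕ) :
    (fairBits (V × V)).real {ω | unlooped (ofBits ω) = U ∧ ¬ Quasirandom (ofBits ω) U n k} =
      (1 / 2) ^ Nat.card V * (fairBits (V × V)).real {ω | ¬ Quasirandom (ofBits ω) U n k} := by
  classical
  have := Fintype.ofFinite V
  let loops : Set (V × V → Bool) := {ω | ∀ x ∈ Finset.univ, ω (x, x) = decide (x ∉ U)}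
  have hloops : ∀ ω, unlooped (ofBits ω) = U ↔ ω ∈ loops := by
    intro ω
    rw [Set.ext_iff]
    refine forall_congr' fun x => ?_
    simp only [unlooped, Looped, ofBits, Set.mem_ofPred_eq, Finset.mem_univ, true_implies]
    by_cases hx : x ∈ U <;> simp [hx]
  simp only [hloops]
  calc _ = (fairBits (V × V)).real loops *
        (fairBits (V × V)).real {ω | ¬ Quasirandom (ofBits ω) U n k} :=
        fairBits_real_inter (dependsOn_forall_eq _ _ _) dependsOn_not_quasirandom (by
          rw [Set.disjoint_left]
          rintro _ ⟨x, -, rfl⟩ hne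
          exact hne rfl)
    _ = _ := by
        rw [fairBits_real_forall_eq (fun x _ y _ hxy => congrArg Prod.fst hxy) _,
          Finset.card_univ, Nat.card_eq_fintype_card]

lemma fairBits_real_not_quasirandom_le_cell (hp : LargeK (kOf p)) (hU : U.card = nOf p)
    (hT : T.card = kOf p) (hUT : Disjoint U T) :
    (fairBits (Fin (numNodes p) × Fin (numNodes p))).real
        {ω | unlooped (ofBits ω) = U ∧ ¬ Quasirandom (ofBits ω) U (nOf p) (kOf p)} ≤
      Real.exp (-kOf p) * (fairBits _).real (cell p U T) := by
  have hqr := fairBits_real_not_quasirandom_le (U : Set (Fin (numNodes p))) (kOf p)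
  rw [Set.ncard_coe_finset, hU, Nat.card_fin] at hqr
  have hN : numNodes p ≤ 3 * nOf p := by
    have := hp.kOf_le_nOf
    rw [numNodes]
    omega
  have herror := error_le hp.le (nOf_mul_le p) hp.pow_mul_pow_le_nOf hN
    (d := 4 * p ^ 2) (by exact_mod_cast four_mul_sq_le p)
  rw [fairBits_real_unlooped_inter_not_quasirandom, Nat.card_fin]
  calc _ ≤ (1 / 2) ^ numNodes p * (Real.exp (-kOf p) *
        ((1 / 2) ^ (kOf p ^ 2 + 2 * kOf p * (4 * p ^ 2)) *
          (1 - 2 * (3 / 4) ^ kOf p) ^ numNodes p / 2)) := by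
        gcongr
        exact hqr.trans herror
    _ = Real.exp (-kOf p) * ((1 / 2) ^ numNodes p *
        ((1 / 2) ^ (kOf p ^ 2 + 2 * kOf p * (4 * p ^ 2)) *
          (1 - 2 * (3 / 4) ^ kOf p) ^ numNodes p / 2)) := by ring
    _ ≤ _ := by
        gcongr
        exact le_fairBits_real_cell hp hU hT hUT

end Cells

section Counting

lemma ofBits_bijective {V : Type*} : Function.Bijective (ofBits (V := V)) := by
  classical
  constructor
  · intro ω ω' h
    ext ⟨x, y⟩
    exact Bool.eq_iff_iff.2 (iff_of_eq (congrArg (fun G => G.Adj x y) h))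
  · intro G
    exact ⟨fun e => decide (G.Adj e.1 e.2), by ext x y; simp [ofBits]⟩

lemma ncard_eq_fairBits_real_mul {V : Type*} [Finite V] (C : Set (Digraph V)) :
    (C.ncard : ℝ) = (fairBits (V × V)).real (ofBits ⁻¹' C) * 2 ^ Nat.card (V × V) := by
  rw [fairBits_real_apply, div_mul_cancel₀ _ (by positivity),
    Set.ncard_preimage_of_injective_subset_range ofBits_bijective.1
      (by rw [ofBits_bijective.2.range_eq]; exact Set.subset_univ _)]

/-- The pairs of disjoint node sets that can be the un-looped nodes and the tournament of a
digraph in `𝒩_p`. -/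
noncomputable def cellIndices (p : ℕ) :
    Finset (Finset (Fin (numNodes p)) × Finset (Fin (numNodes p))) :=
  {c | c.1.card = nOf p ∧ c.2.card = kOf p ∧ Disjoint c.1 c.2}

variable {p : ℕ}

lemma mem_cellIndices {c : Finset (Fin (numNodes p)) × Finset (Fin (numNodes p))} :
    c ∈ cellIndices p ↔ c.1.card = nOf p ∧ c.2.card = kOf p ∧ Disjoint c.1 c.2 := by
  simp [cellIndices]

lemma cellIndices_nonempty (hp : LargeK (kOf p)) : (cellIndices p).Nonempty := by
  have hk := hp.le
  have hkn := hp.kOf_le_nOf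
  obtain ⟨U, -, hU⟩ := Finset.exists_subset_card_eq
    (show nOf p ≤ (Finset.univ : Finset (Fin (numNodes p))).card by
      rw [Finset.card_univ, Fintype.card_fin, numNodes]
      omega)
  obtain ⟨T, hTU, hT⟩ := Finset.exists_subset_card_eq (show kOf p ≤ Uᶜ.card by
    rw [Finset.card_compl, Fintype.card_fin, hU, numNodes]
    omega)
  exact ⟨(U, T), mem_cellIndices.2
    ⟨hU, hT, Finset.disjoint_right.2 fun x hx => Finset.mem_compl.1 (hTU hx)⟩⟩

lemma pairwiseDisjoint_cell (p : ℕ) :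
    (SetLike.coe (cellIndices p)).PairwiseDisjoint fun c => cell p c.1 c.2 := by
  rintro ⟨U, T⟩ - ⟨U', T'⟩ - hne
  rw [Function.onFun, Set.disjoint_left]
  rintro ω ⟨-, hU, hT⟩ ⟨-, hU', hT'⟩
  exact hne (Prod.ext (Finset.coe_injective (hU.symm.trans hU'))
    (Finset.coe_injective (Set.singleton_injective (hT.symm.trans hT'))))

lemma sum_fairBits_real_cell_le (p : ℕ) :
    ∑ c ∈ cellIndices p, (fairBits _).real (cell p c.1 c.2) ≤
      (fairBits _).real (ofBits ⁻¹' classN p) := by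
  rw [← measureReal_biUnion_finset (pairwiseDisjoint_cell p)
    fun c _ => (Set.toFinite _).measurableSet]
  exact measureReal_mono (Set.iUnion₂_subset fun c _ ω hω => hω.1)

lemma fairBits_real_classN_pos (hp : LargeK (kOf p)) :
    0 < (fairBits _).real (ofBits ⁻¹' classN p) := by
  refine lt_of_lt_of_le (Finset.sum_pos (fun c hc => ?_) (cellIndices_nonempty hp))
    (sum_fairBits_real_cell_le p)
  obtain ⟨hU, hT, hUT⟩ := mem_cellIndices.1 hc
  exact fairBits_real_cell_pos hp hU hT hUT

lemma preimage_not_blanksForced_subset (hp : LargeK (kOf p)) :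
    ofBits ⁻¹' {G ∈ classN p | ¬ BlanksForced G p} ⊆ ⋃ c ∈ cellIndices p,
      {ω | unlooped (ofBits ω) = c.1 ∧ ¬ Quasirandom (ofBits ω) c.1 (nOf p) (kOf p)} := by
  classical
  rintro ω ⟨⟨T, hT, hU, -, hZero, hConn, hLooped⟩, hω⟩
  have hk := hp.le
  have hkn := hp.kOf_le_nOf
  have hmem : IsTournament (ofBits ω) T ∧ T.ncard = kOf p := hT.ge rfl
  refine Set.mem_iUnion₂.2 ⟨((unlooped (ofBits ω)).toFinset, T.toFinset),
    mem_cellIndices.2 ⟨?_, ?_, ?_⟩, by simp, fun hquasi => ?_⟩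
  · rw [← Set.ncard_eq_toFinset_card', hU]
  · rw [← Set.ncard_eq_toFinset_card', hmem.2]
  · rw [Set.disjoint_toFinset]
    exact (Set.subset_compl_iff_disjoint_left.1 hmem.1.subset_compl_unlooped)
  · rw [Set.coe_toFinset] at hquasi
    exact hω (blanksForced_of_quasirandom (by rw [Nat.card_fin, numNodes]; omega) (by omega)
      (by omega) hT hU hZero hConn hLooped hquasi)

lemma fairBits_real_not_blanksForced_le (hp : LargeK (kOf p)) :
    (fairBits _).real (ofBits ⁻¹' {G ∈ classN p | ¬ BlanksForced G p}) ≤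
      Real.exp (-kOf p) * (fairBits _).real (ofBits ⁻¹' classN p) := by
  calc _ ≤ _ := measureReal_mono (preimage_not_blanksForced_subset hp) (measure_ne_top _ _)
    _ ≤ _ := measureReal_biUnion_finset_le _ _
    _ ≤ ∑ c ∈ cellIndices p, Real.exp (-kOf p) * (fairBits _).real (cell p c.1 c.2) :=
        Finset.sum_le_sum fun c hc => by
          obtain ⟨hU, hT, hUT⟩ := mem_cellIndices.1 hc
          exact fairBits_real_not_quasirandom_le_cell hp hU hT hUT
    _ ≤ _ := by
        rw [← Finset.mul_sum]
        gcongr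
        exact sum_fairBits_real_cell_le p

lemma one_sub_exp_le_ncard_div_ncard (hp : LargeK (kOf p)) :
    1 - Real.exp (-kOf p) ≤
      ({G ∈ classN p | BlanksForced G p}.ncard : ℝ) / ((classN p).ncard : ℝ) := by
  have hsplit : (fairBits _).real (ofBits ⁻¹' classN p) ≤
      (fairBits _).real (ofBits ⁻¹' {G ∈ classN p | BlanksForced G p}) +
        (fairBits _).real (ofBits ⁻¹' {G ∈ classN p | ¬ BlanksForced G p}) := by
    refine (measureReal_mono fun ω hω => ?_).trans (measureReal_union_le _ _)
    exact (em (BlanksForced (ofBits ω) p)).imp (⟨hω, ·⟩) (⟨hω, ·⟩)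
  rw [ncard_eq_fairBits_real_mul, ncard_eq_fairBits_real_mul,
    mul_div_mul_right _ _ (by positivity), le_div_iff₀ (fairBits_real_classN_pos hp)]
  linarith [fairBits_real_not_blanksForced_le hp]

end Counting

end GraphColoration

theorem proposition4 :
    Tendsto
      (fun p : ℕ =>
        ({G ∈ GraphColoration.classN p | GraphColoration.BlanksForced G p}.ncard : ℝ) /
          ((GraphColoration.classN p).ncard : ℝ))
      atTop (𝓝 1) := by
  have hlim : Tendsto (fun p : ℕ => 1 - Real.exp (-GraphColoration.kOf p)) atTop (𝓝 1) := by
    simpa using (Real.tendsto_exp_neg_atTop_nhds_zero.comp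
      (tendsto_natCast_atTop_atTop.comp GraphColoration.tendsto_kOf)).const_sub 1
  refine tendsto_of_tendsto_of_tendsto_of_le_of_le' hlim tendsto_const_nhds ?_ ?_
  · filter_upwards [GraphColoration.tendsto_kOf.eventually GraphColoration.eventually_largeK]
      with p hp
    exact GraphColoration.one_sub_exp_le_ncard_div_ncard hp
  · refine Eventually.of_forall fun p => div_le_one_of_le₀ ?_ (by positivity)
    exact_mod_cast Set.ncard_le_ncard (Set.sep_subset _ _)
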